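/- Theorem 2. Number the queues of a $2\times2$ input-queued switch row by row (rows are input ports, columns are output ports): $1,2$ in the first row, $3,4$ in the second. Let $\nu=(\nu_1,\nu_2,\nu_3,\nu_4)$ have strictly positive entries with $\nu_1+\nu_2=\nu_3+\nu_4=\nu_1+\nu_3=\nu_2+\nu_4=1$ (complete saturation). For each $\epsilon\in(0,1)$ consider a discrete-time switch in which, in every slot, the arrivals $a_1,\dots,a_4\in\{0,1,2,\dots\}$ are independent of each other and of the past, are i.i.d. over the slots, are bounded by a constant $A_{\max}$ that does not depend on $\epsilon$, and satisfy $E[a_i]=(1-\epsilon)\nu_i$; assume $\mathrm{Var}(a_i)\to\sigma_{a_i}^2$ as $\epsilon\downarrow0$. A feasible schedule is $s\in\{0,1\}^4$ with at most one active queue in each row and column; MaxWeight uses, in each slot, a maximal feasible schedule that maximizes $\sum_i q_is_i$ over all feasible schedules, ties being broken at random (by any law that depends only on $q$ and $\epsilon$). The queues evolve by $q_i^+=q_i+a_i-s_i+u_i$, where $u_i=\max\{s_i-q_i-a_i,0\}$ is the unused service. Let $\bar q$ have a stationary distribution of this Markov chain, and let $\bar s,\bar a,\bar u,\bar q^+$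 be the corresponding schedule, arrivals, unused service and next queue lengths (all depend on $\epsilon$). Let $\bar q_\parallel$ be the orthogonal projection of $\bar q$ on the span $\mathcal H$ of $(1,1,0,0),(0,0,1,1),(1,0,1,0),(0,1,0,1)$. Then for every $\epsilon\in(0,1)$ all expectations below are finite, and the drift of each quadratic monomial in the projected queue lengths vanishes in steady state: $E[\bar q_{\parallel i}^+\bar q_{\parallel j}^+-\bar q_{\parallel i}\bar q_{\parallel j}]=0$ for all $i,j$. As $\epsilon\downarrow0$, the quantities $\epsilon E[\bar q_i]$ and the eight cross terms $E[\bar q_i^+\bar u_j]$ in the equations below stay bounded, and the following six equations hold: $$\lim\epsilon E[\bar q_1]=\tfrac{9\sigma_{a_1}^2+\sigma_{a_2}^2+\sigma_{a_3}^2+\sigma_{a_4}^2}{16}+\tfrac12\lim E[\bar q_1^+(\bar u_2+\bar u_3)]-\tfrac12\lim E[(\bar q_2^++\bar q_3^+)\bar u_4],$$ $$\lim\epsilon E[\bar q_2]=\tfrac{\sigma_{a_1}^2+9\sigma_{a_2}^2+\sigma_{a_3}^2+\sigma_{a_4}^2}{16}+\tfrac12\lim E[\bar q_2^+(\bar u_1-\bar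 u_3+\bar u_4)],$$ $$\lim\epsilon E[\bar q_3]=\tfrac{\sigma_{a_1}^2+\sigma_{a_2}^2+9\sigma_{a_3}^2+\sigma_{a_4}^2}{16}+\tfrac12\lim E[\bar q_3^+(\bar u_1-\bar u_2+\bar u_4)],$$ $$\lim\epsilon E[\bar q_1+\bar q_2]=\tfrac{3\sigma_{a_1}^2+3\sigma_{a_2}^2-\sigma_{a_3}^2-\sigma_{a_4}^2}{8}+\tfrac12\lim E[\bar q_1^+(3\bar u_2-\bar u_3)]+\tfrac12\lim E[\bar q_2^+(3\bar u_1+\bar u_3)]+\tfrac12\lim E[\bar q_3^+\bar u_4],$$ $$\lim\epsilon E[\bar q_1+\bar q_3]=\tfrac{3\sigma_{a_1}^2-\sigma_{a_2}^2+3\sigma_{a_3}^2-\sigma_{a_4}^2}{8}+\tfrac12\lim E[\bar q_1^+(-\bar u_2+3\bar u_3)]+\tfrac12\lim E[\bar q_2^+\bar u_4]+\tfrac12\lim E[\bar q_3^+(3\bar u_1+\bar u_2)],$$ $$\lim\epsilon E[\bar q_2+\bar q_3]=\tfrac{\sigma_{a_1}^2-3\sigma_{a_2}^2-3\sigma_{a_3}^2+\sigma_{a_4}^2}{8}+\tfrac12\lim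 E[\bar q_2^+(\bar u_1+3\bar u_3+\bar u_4)]+\tfrac12\lim E[\bar q_3^+(\bar u_1+3\bar u_2+\bar u_4)].$$ Here each equation holds in the sense that the left-hand quantity minus the combination of cross terms on the right converges, as $\epsilon\downarrow0$, to the stated combination of variances; consequently, whenever the eleven limits $\lim\epsilon E[\bar q_i]$ ($i=1,2,3$) and $\lim E[\bar q_i^+\bar u_j]$ (eight pairs) exist, as $\epsilon\downarrow0$ or along a sequence $\epsilon_n\downarrow0$, they solve this system. The system (6 linear equations in 11 real unknowns) is underdetermined and determines none of the individual queue lengths: for each $i\in\{1,2,3\}$ and each real $t$ it has a solution in which the unknown $\lim\epsilon E[\bar q_i]$ equals $t$. -/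

import Mathlib

open MeasureTheory ProbabilityTheory Filter Topology Asymptotics

noncomputable section

namespace InputQueuedSwitch

/-! The four queues of a `2 × 2` switch are listed row by row (rows are input ports, columns are
output ports): queue `k` of the usual numbering `1, 2, 3, 4` has index `k - 1 : Fin 4`. -/

/-- Vectors of queue lengths, of numbers of arrivals, of potential service, of unused service. -/
abbrev Vec : Type := Fin 4 → ℕ

/-- Feasible schedules: 0-1 vectors with at most one active queue in each row and column. -/
def IsFeasible (s : Vec) : Prop :=
  (∀ i, s i ≤ 1) ∧ s 0 + s 1 ≤ 1 ∧ s 2 + s 3 ≤ 1 ∧ s 0 + s 2 ≤ 1 ∧ s 1 + s 3 ≤ 1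

/-- `s` is a MaxWeight schedule for the queue lengths `q`: it is a maximal feasible schedule and
its weight `⟨q, s⟩` is the largest among all feasible schedules. -/
def IsMaxWeight (q s : Vec) : Prop :=
  Maximal IsFeasible s ∧ ∀ x, IsFeasible x → ∑ i, q i * x i ≤ ∑ i, q i * s i

/-- A MaxWeight policy: given the queue lengths `q`, the schedule is drawn from the law `κ q`, which
is carried by the MaxWeight schedules for `q`; so ties are broken at random, with any law. -/
def IsMaxWeightPolicy (κ : Kernel Vec Vec) : Prop :=
  ∀ q, ∀ᵐ s ∂(κ q), IsMaxWeight q s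

/-- What happens in one time slot: (queue lengths at its beginning, (schedule, arrivals)). -/
abbrev Slot : Type := Vec × (Vec × Vec)

namespace Slot

/-- Queue lengths `q` at the beginning of the slot. -/
def queue (x : Slot) : Vec := x.1

/-- Potential service `s` in the slot. -/
def service (x : Slot) : Vec := x.2.1

/-- Arrivals `a` in the slot. -/
def arrivals (x : Slot) : Vec := x.2.2

/-- Unused service: `u i = max (s i - (q i + a i)) 0` (truncated subtraction). -/
def unused (x : Slot) : Vec := fun i => x.service i - (x.queue i + x.arrivals i)

/-- Queue lengths at the beginning of the next slot: `q⁺ = q + a - s + u`. -/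
def next (x : Slot) : Vec := fun i => x.queue i + x.arrivals i + x.unused i - x.service i

/-- The dynamics `q⁺ + s = q + a + u` in `ℕ`: no truncation takes place in `next`. -/
theorem next_add_service (x : Slot) (i : Fin 4) :
    x.next i + x.service i = x.queue i + x.arrivals i + x.unused i := by
  unfold next unused
  omega

/-- `q⁺ i * u i = 0`. -/
theorem next_mul_unused (x : Slot) (i : Fin 4) : x.next i * x.unused i = 0 := by
  unfold next unused
  rcases le_total (x.service i) (x.queue i + x.arrivals i) with h | h
  · simp [Nat.sub_eq_zero_of_le h]
  · have : x.queue i + x.arrivals i + (x.service i - (x.queue i + x.arrivals i))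
        - x.service i = 0 := by omega
    simp [this]

end Slot

/-- Given the queue lengths, the schedule (drawn from `κ`) and the arrivals (independent across
queues, the arrivals to queue `i` having law `α i`) are independent. -/
def slotKernel (α : Fin 4 → Measure ℕ) (κ : Kernel Vec Vec) : Kernel Vec (Vec × Vec) :=
  κ ×ₖ Kernel.const Vec (Measure.pi α)

/-- Transition kernel of the Markov chain of queue lengths. -/
def transition (α : Fin 4 → Measure ℕ) (κ : Kernel Vec Vec) : Kernel Vec Vec :=
  (Kernel.id ×ₖ slotKernel α κ).map Slot.next

/-- Law of a slot that starts with queue lengths of law `π`, i.e. the joint law of the queue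
lengths, the schedule and the arrivals. -/
def slotLaw (α : Fin 4 → Measure ℕ) (κ : Kernel Vec Vec) (π : Measure Vec) : Measure Slot :=
  π ⊗ₘ slotKernel α κ

/-- `ε E[q i]` in the system with parameter `ε`. -/
def scaledMean (α : ℝ → Fin 4 → Measure ℕ) (κ : ℝ → Kernel Vec Vec) (π : ℝ → Measure Vec)
    (ε : ℝ) (i : Fin 4) : ℝ :=
  ε * ∫ x, (x.queue i : ℝ) ∂(slotLaw (α ε) (κ ε) (π ε))

/-- `E[q⁺ i * u j]` in the system with parameter `ε`. -/
def crossMean (α : ℝ → Fin 4 → Measure ℕ) (κ : ℝ → Kernel Vec Vec) (π : ℝ → Measure Vec)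
    (ε : ℝ) (i j : Fin 4) : ℝ :=
  ∫ x, (x.next i : ℝ) * (x.unused j : ℝ) ∂(slotLaw (α ε) (κ ε) (π ε))

/-- Normal vectors of the four port constraints (two rows, two columns) of the capacity region
`{x ≥ 0 : ⟨c ℓ, x⟩ ≤ 1 for all ℓ}`. -/
def portVec : Fin 4 → EuclideanSpace ℝ (Fin 4) :=
  ![!₂[1, 1, 0, 0], !₂[0, 0, 1, 1], !₂[1, 0, 1, 0], !₂[0, 1, 0, 1]]

/-- The space of state space collapse of the completely saturated switch. -/
def collapseSpace : Submodule ℝ (EuclideanSpace ℝ (Fin 4)) :=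
  Submodule.span ℝ (Set.range portVec)

/-- The projection of a vector on the space of state space collapse. -/
def proj (q : Vec) : EuclideanSpace ℝ (Fin 4) :=
  collapseSpace.starProjection (WithLp.toLp 2 fun i => (q i : ℝ))

/-- The quadratic monomial `q∥ i * q∥ j` in the projected queue lengths. -/
def monomial (i j : Fin 4) (q : Vec) : ℝ := proj q i * proj q j

/-- The pairs `(i, j)` of the eight cross terms `E[q⁺ i * u j]`. In the numbering `1, 2, 3, 4`:
`(1,2), (1,3), (2,1), (2,3), (2,4), (3,1), (3,2), (3,4)`. -/
def crossPair : Fin 8 → Fin 4 × Fin 4 :=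
  ![(0, 1), (0, 2), (1, 0), (1, 2), (1, 3), (2, 0), (2, 1), (2, 3)]

/-- The system of six linear equations in the eleven unknowns `v 0, v 1, v 2` (limits of
`ε E[q i]`) and `w 0, …, w 7` (limits of the cross terms, in the order of `crossPair`). -/
def QuadraticSystem (σ : Fin 4 → ℝ) (v : Fin 3 → ℝ) (w : Fin 8 → ℝ) : Prop :=
  v 0 = (9 * σ 0 ^ 2 + σ 1 ^ 2 + σ 2 ^ 2 + σ 3 ^ 2) / 16
    + 1 / 2 * (w 0 + w 1) - 1 / 2 * (w 4 + w 7) ∧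
  v 1 = (σ 0 ^ 2 + 9 * σ 1 ^ 2 + σ 2 ^ 2 + σ 3 ^ 2) / 16
    + 1 / 2 * (w 2 - w 3 + w 4) ∧
  v 2 = (σ 0 ^ 2 + σ 1 ^ 2 + 9 * σ 2 ^ 2 + σ 3 ^ 2) / 16
    + 1 / 2 * (w 5 - w 6 + w 7) ∧
  v 0 + v 1 = (3 * σ 0 ^ 2 + 3 * σ 1 ^ 2 - σ 2 ^ 2 - σ 3 ^ 2) / 8
    + 1 / 2 * (3 * w 0 - w 1) + 1 / 2 * (3 * w 2 + w 3) + 1 / 2 * w 7 ∧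
  v 0 + v 2 = (3 * σ 0 ^ 2 - σ 1 ^ 2 + 3 * σ 2 ^ 2 - σ 3 ^ 2) / 8
    + 1 / 2 * (-w 0 + 3 * w 1) + 1 / 2 * w 4 + 1 / 2 * (3 * w 5 + w 6) ∧
  v 1 + v 2 = (σ 0 ^ 2 - 3 * σ 1 ^ 2 - 3 * σ 2 ^ 2 + σ 3 ^ 2) / 8
    + 1 / 2 * (w 2 + 3 * w 3 + w 4) + 1 / 2 * (w 5 + 3 * w 6 + w 7)

end InputQueuedSwitch

end

open InputQueuedSwitch

namespace InputQueuedSwitch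

set_option linter.unusedSectionVars false

/-! MaxWeight only ever uses the two perfect matchings, and `ν` is a convex combination of them with
both weights positive. A linear form with the same value on both matchings (`IsBalancedForm`) cannot
see which of them was chosen: its increment in a slot is centred arrivals, plus unused service,
minus a constant of order `ε`. Stationarity of the product of two such forms gives an exact
identity, `IsSteadySlot.quadratic_drift`, linking `ε E[q]`, the cross terms `E[q⁺ u]`, the means of
products of unused services and the arrival variances. The rows of the projection matrix `projForm`
are balanced forms, and the six equations are the limits of this identity for pairs of its first
three rows.

The limit rests on three estimates. Second moments are finite for each fixed `ε`, by a
Foster-Lyapunov argument for the distance to `0`, whose drift has order `ε`; this makes stationarity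
usable. Each unused service has mean at most `ε`, so the products of unused services disappear.
State space collapse is the same Foster-Lyapunov argument for the distance to the cone where both
matchings weigh the same; there the drift stays away from zero as `ε ↓ 0`, so the second moment of
`imbalance` is bounded uniformly in `ε`. By Cauchy-Schwarz the cross terms of the imbalance with
unused service are `O(√ε)`. Hence projected queues may be replaced by queues, and `E[q⁺ 0 * u 3]`,
which is not among the eight cross terms, can be eliminated.

The vanishing drift of the monomials is stationarity plus integrability. Underdetermination is shown
by an explicit two-parameter family of solutions. -/

/-- The properties of the law `μ` of a slot in steady state: `lam` and `var` are the means and the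
variances of the arrivals, `A` is a bound on the arrivals. -/
structure IsSteadySlot (μ : Measure Slot) (lam var : Fin 4 → ℝ) (A : ℕ) : Prop where
  map_next : μ.map Slot.next = μ.map Slot.queue
  maxWeight : ∀ᵐ x ∂μ, IsMaxWeight x.queue x.service
  arrivals_le : ∀ᵐ x ∂μ, ∀ i, x.arrivals i ≤ A
  integral_mul_arrivals : ∀ (h : Vec → ℝ) (i : Fin 4),
    ∫ x, h x.queue * (x.arrivals i : ℝ) ∂μ = (∫ x, h x.queue ∂μ) * lam i
  covariance : ∀ i j, ∫ x, ((x.arrivals i : ℝ) - lam i) * ((x.arrivals j : ℝ) - lam j) ∂μ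
    = if i = j then var i else 0

/-! ### From the kernels of the model to the steady-state slot -/

section SlotLaw

variable (α : Fin 4 → Measure ℕ) [∀ i, IsProbabilityMeasure (α i)]
  (κ : Kernel Vec Vec) [IsMarkovKernel κ] (π : Measure Vec) [IsProbabilityMeasure π]

instance : IsMarkovKernel (slotKernel α κ) := by unfold slotKernel; infer_instance

instance : IsProbabilityMeasure (slotLaw α κ π) := by unfold slotLaw; infer_instance

theorem map_queue_slotLaw : (slotLaw α κ π).map Slot.queue = π :=
  Measure.fst_compProd π (slotKernel α κ)

theorem map_next_slotLaw : (slotLaw α κ π).map Slot.next = π.bind (transition α κ) := by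
  rw [slotLaw, transition, Measure.compProd_eq_comp_prod,
    Measure.map_comp _ _ (Measurable.of_discrete)]

theorem map_snd_slotKernel (q : Vec) : (slotKernel α κ q).map Prod.snd = Measure.pi α := by
  rw [slotKernel, Kernel.prod_apply, Kernel.const_apply]
  exact Measure.snd_prod

/-- The arrival marginal of `slotKernel` does not depend on the queue lengths, so integrating out
the schedule leaves a product measure. -/
theorem map_queue_arrivals_slotLaw :
    (slotLaw α κ π).map (fun x => (x.queue, x.arrivals)) = π.prod (Measure.pi α) := by
  have h : (fun x : Slot => (x.queue, x.arrivals)) = Prod.map id Prod.snd := rfl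
  rw [h, slotLaw, ← Measure.compProd_map measurable_snd, ← Measure.compProd_const]
  congr 1
  ext1 q
  rw [Kernel.map_apply _ measurable_snd, map_snd_slotKernel, Kernel.const_apply]

theorem map_arrivals_slotLaw : (slotLaw α κ π).map Slot.arrivals = Measure.pi α := by
  have h : (slotLaw α κ π).map Slot.arrivals
      = ((slotLaw α κ π).map (fun x => (x.queue, x.arrivals))).map Prod.snd := by
    rw [Measure.map_map Measurable.of_discrete Measurable.of_discrete]
    rfl
  rw [h, map_queue_arrivals_slotLaw]
  exact Measure.snd_prod

/-- This is the only bridge from the model to the analysis: the estimates below use `IsSteadySlot`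
alone. The tie-breaking law matters only through its support. -/
theorem isSteadySlot_slotLaw {lam : Fin 4 → ℝ} {A : ℕ}
    (hA : ∀ i, ∀ᵐ n ∂(α i), n ≤ A) (hlam : ∀ i, ∫ n, (n : ℝ) ∂(α i) = lam i)
    (hκ : IsMaxWeightPolicy κ) (hπ : Kernel.Invariant (transition α κ) π) :
    IsSteadySlot (slotLaw α κ π) lam (fun i => variance (fun n : ℕ => (n : ℝ)) (α i)) A where
  map_next := by
    rw [map_next_slotLaw, map_queue_slotLaw]
    exact hπ
  maxWeight := by
    refine Measure.ae_compProd_of_ae_ae (.of_discrete) (ae_of_all _ fun q => ?_)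
    have hm : (slotKernel α κ q).map Prod.fst = κ q := by
      rw [slotKernel, Kernel.prod_apply, Kernel.const_apply]
      exact Measure.fst_prod
    have := hκ q
    rw [← hm] at this
    exact ae_of_ae_map measurable_fst.aemeasurable this
  arrivals_le := by
    have h : ∀ᵐ a ∂(Measure.pi α), ∀ i, a i ≤ A := by
      rw [ae_all_iff]
      intro i
      have := hA i
      rw [← (measurePreserving_eval α i).map_eq] at this
      exact ae_of_ae_map (measurable_pi_apply i).aemeasurable this
    rw [← map_arrivals_slotLaw α κ π] at h
    exact ae_of_ae_map (Measurable.of_discrete).aemeasurable h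
  integral_mul_arrivals h i := by
    have h1 : ∫ x, h x.queue * (x.arrivals i : ℝ) ∂(slotLaw α κ π)
        = ∫ y : Vec × Vec, h y.1 * (y.2 i : ℝ) ∂(π.prod (Measure.pi α)) := by
      rw [← map_queue_arrivals_slotLaw α κ π, integral_map (Measurable.of_discrete).aemeasurable
        (Measurable.of_discrete).aestronglyMeasurable]
    have h2 : ∫ x, h x.queue ∂(slotLaw α κ π) = ∫ q, h q ∂π := by
      conv_rhs => rw [← map_queue_slotLaw α κ π]
      rw [integral_map (Measurable.of_discrete).aemeasurable
        (Measurable.of_discrete).aestronglyMeasurable]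
    have h3 : ∫ a : Vec, (a i : ℝ) ∂(Measure.pi α) = lam i := by
      rw [← hlam i]
      conv_rhs => rw [← (measurePreserving_eval α i).map_eq]
      rw [integral_map (Measurable.of_discrete).aemeasurable
        (Measurable.of_discrete).aestronglyMeasurable]
    -- The product formula holds for every `h`, integrable or not, since the Bochner integral of a
    -- nonintegrable function is `0`.
    rw [h1, integral_prod_mul h (fun a : Vec => (a i : ℝ)), h2, h3]
  covariance i j := by
    have h1 : ∫ x, ((x.arrivals i : ℝ) - lam i) * ((x.arrivals j : ℝ) - lam j) ∂(slotLaw α κ π)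
        = ∫ a : Vec, ((a i : ℝ) - lam i) * ((a j : ℝ) - lam j) ∂(Measure.pi α) := by
      rw [← map_arrivals_slotLaw α κ π, integral_map (Measurable.of_discrete).aemeasurable
        (Measurable.of_discrete).aestronglyMeasurable]
    have hm : ∀ k (f : ℕ → ℝ), ∫ a : Vec, f (a k) ∂(Measure.pi α) = ∫ n, f n ∂(α k) := by
      intro k f
      conv_rhs => rw [← (measurePreserving_eval α k).map_eq]
      rw [integral_map (Measurable.of_discrete).aemeasurable
        (Measurable.of_discrete).aestronglyMeasurable]
    rw [h1]
    split_ifs with hij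
    · subst hij
      rw [variance_eq_integral (Measurable.of_discrete).aemeasurable, hlam i,
        ← hm i (fun n => ((n : ℝ) - lam i) ^ 2)]
      simp only [sq]
    · have hind := (iIndepFun_pi (μ := α) (X := fun k (n : ℕ) => (n : ℝ) - lam k)
        (fun k => (Measurable.of_discrete).aemeasurable)).indepFun hij
      have hint : Integrable (fun n : ℕ => (n : ℝ)) (α i) := by
        refine Integrable.of_bound (Measurable.of_discrete).aestronglyMeasurable (A : ℝ) ?_
        filter_upwards [hA i] with n hn
        simpa using hn
      have h0 : ∫ n : ℕ, ((n : ℝ) - lam i) ∂(α i) = 0 := by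
        rw [integral_sub hint (integrable_const _), hlam i]
        simp
      have := hind.integral_fun_mul_eq_mul_integral
        (Measurable.of_discrete).aestronglyMeasurable (Measurable.of_discrete).aestronglyMeasurable
      rw [this, hm i (fun n => (n : ℝ) - lam i), h0, zero_mul]

end SlotLaw

/-! ### Foster-Lyapunov moment bounds -/

/-- The constant in the drift of the fourth power of a Lyapunov function. -/
noncomputable def driftConst (c B : ℝ) : ℝ :=
  (2 * B + 2 * B ^ 2) + (2 * B + 2 * B ^ 2) ^ 3 / c ^ 2

/-- If `D ^ 2` grows by at most `Y` with `|Y| ≤ B (D + 1)` and conditional mean at most `-c D + B`,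
the left side bounds the drift of `D ^ 4`. The quadratic term `G D ^ 2` is absorbed by `c D ^ 3`
when `D ≥ G / c`, and is at most `G ^ 3 / c ^ 2` otherwise. -/
theorem quartic_drift_le {c B D : ℝ} (hc : 0 < c) (hB : 0 ≤ B) (hD : 0 ≤ D) :
    2 * D ^ 2 * (-c * D + B) + B ^ 2 * (D + 1) ^ 2 ≤ -c * D ^ 3 + driftConst c B := by
  set G := 2 * B + 2 * B ^ 2 with hG
  have hG0 : 0 ≤ G := by positivity
  have h1 : 2 * D ^ 2 * (-c * D + B) + B ^ 2 * (D + 1) ^ 2 ≤ -(2 * c) * D ^ 3 + G * D ^ 2 + G := by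
    nlinarith [mul_nonneg (sq_nonneg B) (sq_nonneg (D - 1))]
  have h2 : G * D ^ 2 ≤ c * D ^ 3 + G ^ 3 / c ^ 2 := by
    rcases le_total G (c * D) with h | h
    · have : G * D ^ 2 ≤ c * D * D ^ 2 := mul_le_mul_of_nonneg_right h (sq_nonneg D)
      have h3 : 0 ≤ G ^ 3 / c ^ 2 := by positivity
      nlinarith
    · have h3 : G * D ^ 2 ≤ G ^ 3 / c ^ 2 := by
        rw [le_div_iff₀ (by positivity)]
        have : (c * D) ^ 2 ≤ G ^ 2 := pow_le_pow_left₀ (by positivity) h 2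
        nlinarith [mul_le_mul_of_nonneg_left this hG0]
      have : 0 ≤ c * D ^ 3 := by positivity
      linarith
  unfold driftConst
  rw [← hG]
  linarith

theorem driftConst_nonneg {c B : ℝ} (hB : 0 ≤ B) : 0 ≤ driftConst c B := by
  unfold driftConst; positivity

theorem integral_next_eq {μ : Measure Slot} (hmap : μ.map Slot.next = μ.map Slot.queue)
    (f : Vec → ℝ) : ∫ x, f x.next ∂μ = ∫ x, f x.queue ∂μ := by
  rw [← integral_map (φ := Slot.next) (Measurable.of_discrete).aemeasurable
    (Measurable.of_discrete).aestronglyMeasurable, hmap,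
    integral_map (Measurable.of_discrete).aemeasurable
    (Measurable.of_discrete).aestronglyMeasurable]

theorem integrable_next_iff {μ : Measure Slot} (hmap : μ.map Slot.next = μ.map Slot.queue)
    (f : Vec → ℝ) : Integrable (fun x => f x.next) μ ↔ Integrable (fun x => f x.queue) μ := by
  have h1 := integrable_map_measure (μ := μ) (f := Slot.next) (g := f)
    (Measurable.of_discrete).aestronglyMeasurable (Measurable.of_discrete).aemeasurable
  have h2 := integrable_map_measure (μ := μ) (f := Slot.queue) (g := f)
    (Measurable.of_discrete).aestronglyMeasurable (Measurable.of_discrete).aemeasurable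
  rw [hmap] at h1
  exact h1.symm.trans h2

/-- Bounds on the truncated integrals of a nonnegative function give integrability. -/
theorem integrable_of_truncated_le {μ : Measure Slot} [IsProbabilityMeasure μ] {D f : Vec → ℝ}
    (hf : ∀ q, 0 ≤ f q) {R : ℝ} (hbdd : ∀ n : ℕ, ∃ M, ∀ q, D q ≤ n → f q ≤ M)
    (h : ∀ n : ℕ, ∫ x, (if D x.queue ≤ n then f x.queue else 0) ∂μ ≤ R) :
    Integrable (fun x => f x.queue) μ ∧ ∫ x, f x.queue ∂μ ≤ R := by
  have hR : 0 ≤ R := (integral_nonneg fun x => by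
    show (0 : ℝ) ≤ if D x.queue ≤ (0 : ℕ) then f x.queue else 0
    split_ifs
    exacts [hf _, le_rfl]).trans (h 0)
  have hn : ∀ n : ℕ, ∫⁻ x, ENNReal.ofReal (if D x.queue ≤ n then f x.queue else 0) ∂μ
      ≤ ENNReal.ofReal R := by
    intro n
    obtain ⟨M, hM⟩ := hbdd n
    rw [← ofReal_integral_eq_lintegral_ofReal]
    · exact ENNReal.ofReal_le_ofReal (h n)
    · refine Integrable.of_bound (Measurable.of_discrete).aestronglyMeasurable (max M 0)
        (ae_of_all _ fun x => ?_)
      split_ifs with hx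
      · rw [Real.norm_of_nonneg (hf _)]
        exact (hM _ hx).trans (le_max_left _ _)
      · simp
    · refine ae_of_all _ fun x => ?_
      show (0 : ℝ) ≤ if D x.queue ≤ n then f x.queue else 0
      split_ifs
      exacts [hf _, le_rfl]
  have hlim : ∫⁻ x, ENNReal.ofReal (f x.queue) ∂μ ≤ ENNReal.ofReal R := by
    refine le_of_tendsto' (lintegral_tendsto_of_tendsto_of_monotone
      (f := fun (n : ℕ) (x : Slot) => ENNReal.ofReal (if D x.queue ≤ n then f x.queue else 0))
      (fun n => (Measurable.of_discrete).aemeasurable) (ae_of_all _ fun x n m hnm => ?_)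
      (ae_of_all _ fun x => ?_)) hn
    · refine ENNReal.ofReal_le_ofReal ?_
      have : (n : ℝ) ≤ m := by exact_mod_cast hnm
      split_ifs with h1 h2
      · exact le_rfl
      · exact absurd (h1.trans this) h2
      · exact hf _
      · exact le_rfl
    · refine tendsto_const_nhds.congr' ?_
      obtain ⟨N, hN⟩ := exists_nat_ge (D x.queue)
      filter_upwards [eventually_ge_atTop N] with n hn
      have : D x.queue ≤ n := hN.trans (by exact_mod_cast hn)
      rw [if_pos this]
  have hint : Integrable (fun x => f x.queue) μ := by
    refine ⟨(Measurable.of_discrete).aestronglyMeasurable, ?_⟩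
    rw [hasFiniteIntegral_iff_ofReal (ae_of_all _ fun x => hf _)]
    exact hlim.trans_lt ENNReal.ofReal_lt_top
  refine ⟨hint, ?_⟩
  rw [← ofReal_integral_eq_lintegral_ofReal hint (ae_of_all _ fun x => hf _)] at hlim
  exact (ENNReal.ofReal_le_ofReal_iff hR).1 hlim

/-- A Foster-Lyapunov bound: in steady state, a function whose square has bounded increments up to
its own size and a negative drift has a third moment, with an explicit bound. -/
theorem integrable_cube_of_drift {μ : Measure Slot} [IsProbabilityMeasure μ]
    (hmap : μ.map Slot.next = μ.map Slot.queue) {D : Vec → ℝ} (hD : ∀ q, 0 ≤ D q)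
    {Y : Slot → ℝ} {c B : ℝ} (hc : 0 < c) (hB : 0 ≤ B)
    (hY : ∀ᵐ x ∂μ, D x.next ^ 2 ≤ D x.queue ^ 2 + Y x)
    (hYB : ∀ᵐ x ∂μ, |Y x| ≤ B * (D x.queue + 1))
    (hdrift : ∀ h : Vec → ℝ, (∀ q, 0 ≤ h q) → (∃ R, ∀ q, h q * (D q + 1) ≤ R) →
      ∫ x, h x.queue * Y x ∂μ ≤ ∫ x, h x.queue * (-c * D x.queue + B) ∂μ) :
    Integrable (fun x => D x.queue ^ 3) μ ∧
      ∫ x, D x.queue ^ 3 ∂μ ≤ driftConst c B / c := by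
  refine integrable_of_truncated_le (D := D) (f := fun q => D q ^ 3)
    (fun q => pow_nonneg (hD q) 3)
    (fun n => ⟨(n : ℝ) ^ 3, fun q hq => pow_le_pow_left₀ (hD q) hq 3⟩) fun n => ?_
  -- Integrability of `D ^ 4` is not known, so stationarity is applied to the bounded function `m =
  -- min (D ^ 4) (n ^ 4)`. Where `D > n` it is already at its maximum and cannot increase, so only
  -- the part selected by `g` contributes to the drift.
  set g : Vec → ℝ := fun q => if D q ≤ n then 1 else 0 with hg
  have hg01 : ∀ q, (D q ≤ n ∧ g q = 1) ∨ ((n : ℝ) ≤ D q ∧ g q = 0) := by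
    intro q
    by_cases hq : D q ≤ n
    · exact Or.inl ⟨hq, if_pos hq⟩
    · exact Or.inr ⟨(not_le.1 hq).le, if_neg hq⟩
  have hg0 : ∀ q, 0 ≤ g q := fun q => by rcases hg01 q with h | h <;> simp [h.2]
  have hg1 : ∀ q, g q ≤ 1 := fun q => by rcases hg01 q with h | h <;> simp [h.2]
  have hint : ∀ f : Vec → ℝ, (∃ M, ∀ q, D q ≤ n → |f q| ≤ M) →
      Integrable (fun x => g x.queue * f x.queue) μ := by
    rintro f ⟨M, hM⟩
    refine Integrable.of_bound (Measurable.of_discrete).aestronglyMeasurable (max M 0)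
      (ae_of_all _ fun x => ?_)
    rcases hg01 x.queue with h | h
    · rw [h.2, one_mul]
      exact (hM _ h.1).trans (le_max_left _ _)
    · rw [h.2]; simp
  set m : Vec → ℝ := fun q => min (D q ^ 4) ((n : ℝ) ^ 4) with hm
  have hmint : ∀ ψ : Slot → Vec, Integrable (fun x => m (ψ x)) μ := fun ψ => by
    refine Integrable.of_bound (Measurable.of_discrete).aestronglyMeasurable ((n : ℝ) ^ 4)
      (ae_of_all _ fun x => ?_)
    rw [Real.norm_of_nonneg (le_min (pow_nonneg (hD _) 4) (by positivity))]
    exact min_le_right _ _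
  have hYint : Integrable (fun x => g x.queue * (2 * D x.queue ^ 2) * Y x) μ := by
    refine Integrable.of_bound (Measurable.of_discrete).aestronglyMeasurable
      (2 * (n : ℝ) ^ 2 * (B * (n + 1))) ?_
    filter_upwards [hYB] with x hx
    rcases hg01 x.queue with h | h
    · rw [h.2, one_mul, norm_mul, Real.norm_of_nonneg (by positivity), Real.norm_eq_abs]
      have h0 := hD x.queue
      have h1 := h.1
      have h2 : |Y x| ≤ B * (n + 1) := hx.trans (by gcongr)
      gcongr
    · rw [h.2]; simp only [zero_mul, norm_zero]; positivity
  have hBint : Integrable (fun x => g x.queue * (B ^ 2 * (D x.queue + 1) ^ 2)) μ :=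
    hint (fun q => B ^ 2 * (D q + 1) ^ 2) ⟨B ^ 2 * (n + 1) ^ 2, fun q hq => by
      have h0 := hD q
      rw [abs_of_nonneg (by positivity)]
      gcongr⟩
  have hcube : Integrable (fun x => g x.queue * D x.queue ^ 3) μ :=
    hint (fun q => D q ^ 3) ⟨(n : ℝ) ^ 3, fun q hq => by
      rw [abs_of_nonneg (pow_nonneg (hD q) 3)]
      exact pow_le_pow_left₀ (hD q) hq 3⟩
  have hstep : ∀ᵐ x ∂μ, m x.next - m x.queue
      ≤ g x.queue * (2 * D x.queue ^ 2) * Y x + g x.queue * (B ^ 2 * (D x.queue + 1) ^ 2) := by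
    filter_upwards [hY, hYB] with x h1 h2
    rcases hg01 x.queue with h | h
    · have h3 : m x.queue = D x.queue ^ 4 := min_eq_left (pow_le_pow_left₀ (hD _) h.1 4)
      have h4 : m x.next ≤ D x.next ^ 4 := min_le_left _ _
      have h5 : D x.next ^ 4 ≤ (D x.queue ^ 2 + Y x) ^ 2 := by
        have := pow_le_pow_left₀ (sq_nonneg (D x.next)) h1 2
        calc D x.next ^ 4 = (D x.next ^ 2) ^ 2 := by ring
          _ ≤ _ := this
      have h6 : Y x ^ 2 ≤ (B * (D x.queue + 1)) ^ 2 := sq_le_sq' (abs_le.1 h2).1 (abs_le.1 h2).2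
      rw [h3, h.2]
      nlinarith
    · have h3 : m x.queue = (n : ℝ) ^ 4 := min_eq_right (pow_le_pow_left₀ (by positivity) h.1 4)
      have h4 : m x.next ≤ (n : ℝ) ^ 4 := min_le_right _ _
      rw [h3, h.2]
      linarith
  have h0 : 0 ≤ ∫ x, (g x.queue * (2 * D x.queue ^ 2) * Y x
      + g x.queue * (B ^ 2 * (D x.queue + 1) ^ 2)) ∂μ := by
    have := integral_mono_ae ((hmint Slot.next).sub (hmint Slot.queue)) (hYint.add hBint) hstep
    simp only [Pi.sub_apply] at this
    rw [integral_sub (hmint _) (hmint _), integral_next_eq hmap m, sub_self] at this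
    exact this
  -- The drift hypothesis, tested against `h`, replaces a conditional expectation given the queue
  -- lengths; the weight `2 D ^ 2` comes from expanding `(D ^ 2 + Y) ^ 2`.
  have h1 := hdrift (fun q => g q * (2 * D q ^ 2))
    (fun q => mul_nonneg (hg0 q) (by positivity)) ⟨2 * (n : ℝ) ^ 2 * (n + 1), fun q => by
      have h0 := hD q
      rcases hg01 q with h | h
      · have := h.1
        rw [h.2, one_mul]
        gcongr
      · rw [h.2]; simp only [zero_mul]; positivity⟩
  have hDint : Integrable (fun x => g x.queue * (2 * D x.queue ^ 2) * (-c * D x.queue + B)) μ := by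
    have := hint (fun q => (2 * D q ^ 2) * (-c * D q + B)) ⟨2 * (n : ℝ) ^ 2 * (c * n + B),
      fun q hq => by
        have h0 := hD q
        rw [abs_mul, abs_of_nonneg (a := 2 * D q ^ 2) (by positivity)]
        have h3 : |-c * D q + B| ≤ c * n + B := by
          have h4 : c * D q ≤ c * n := by gcongr
          have h5 : 0 ≤ c * D q := by positivity
          rw [abs_le]
          constructor <;> linarith
        gcongr⟩
    simpa only [mul_assoc] using this
  rw [integral_add hYint hBint] at h0
  have h2 : ∫ x, g x.queue * (2 * D x.queue ^ 2) * (-c * D x.queue + B) ∂μ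
      + ∫ x, g x.queue * (B ^ 2 * (D x.queue + 1) ^ 2) ∂μ
      ≤ ∫ x, (-c * (g x.queue * D x.queue ^ 3) + driftConst c B) ∂μ := by
    rw [← integral_add hDint hBint]
    refine integral_mono (hDint.add hBint) ((hcube.const_mul _).add (integrable_const _))
      fun x => ?_
    have h3 := quartic_drift_le hc hB (hD x.queue)
    have h4 := driftConst_nonneg (c := c) hB
    have h5 := hg0 x.queue
    have h6 := hg1 x.queue
    show g x.queue * (2 * D x.queue ^ 2) * (-c * D x.queue + B)
      + g x.queue * (B ^ 2 * (D x.queue + 1) ^ 2) ≤ -c * (g x.queue * D x.queue ^ 3) + driftConst c B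
    nlinarith [mul_le_mul_of_nonneg_left h3 h5, mul_le_mul_of_nonneg_right h6 h4]
  rw [integral_add (hcube.const_mul _) (integrable_const _), integral_const_mul,
    integral_const] at h2
  simp only [probReal_univ, smul_eq_mul, one_mul] at h2
  have h3 : ∫ x, (if D x.queue ≤ n then D x.queue ^ 3 else 0) ∂μ
      = ∫ x, g x.queue * D x.queue ^ 3 ∂μ := by
    refine integral_congr_ae (ae_of_all _ fun x => ?_)
    simp [hg]
  rw [h3, le_div_iff₀ hc]
  linarith

/-! ### MaxWeight schedules and one slot of the dynamics -/

theorem isFeasible_diag : IsFeasible ![1, 0, 0, 1] := by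
  refine ⟨fun i => by fin_cases i <;> simp, ?_⟩
  simp

theorem isFeasible_antidiag : IsFeasible ![0, 1, 1, 0] := by
  refine ⟨fun i => by fin_cases i <;> simp, ?_⟩
  simp

/-- The MaxWeight schedules are the two perfect matchings, chosen by weight. -/
theorem IsMaxWeight.cases {q s : Vec} (h : IsMaxWeight q s) :
    (s 0 = 1 ∧ s 1 = 0 ∧ s 2 = 0 ∧ s 3 = 1 ∧ q 1 + q 2 ≤ q 0 + q 3) ∨
    (s 0 = 0 ∧ s 1 = 1 ∧ s 2 = 1 ∧ s 3 = 0 ∧ q 0 + q 3 ≤ q 1 + q 2) := by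
  obtain ⟨⟨⟨h1, h2, h3, h4, h5⟩, hmax⟩, hw⟩ := h
  -- A feasible schedule lies below one of the two matchings: a service in queue `1` or `2` blocks
  -- both `0` and `3`. Maximality then forces equality.
  by_cases hs : s 1 = 0 ∧ s 2 = 0
  · left
    have hle : s ≤ ![1, 0, 0, 1] := by
      intro i
      have := h1 i
      fin_cases i <;> simp_all
    have hge := hmax isFeasible_diag hle
    have h0 := hge 0
    have h3' := hge 3
    have := hw _ isFeasible_antidiag
    simp only [Fin.sum_univ_four] at this
    have e0 : s 0 = 1 := le_antisymm (h1 0) (by simpa using h0)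
    have e3 : s 3 = 1 := le_antisymm (h1 3) (by simpa using h3')
    refine ⟨e0, hs.1, hs.2, e3, ?_⟩
    simpa [hs.1, hs.2, e0, e3] using this
  · right
    have hz : s 0 = 0 ∧ s 3 = 0 := by omega
    have hle : s ≤ ![0, 1, 1, 0] := by
      intro i
      have := h1 i
      fin_cases i <;> simp_all
    have hge := hmax isFeasible_antidiag hle
    have h0 := hge 1
    have h3' := hge 2
    have := hw _ isFeasible_diag
    simp only [Fin.sum_univ_four] at this
    have e1 : s 1 = 1 := le_antisymm (h1 1) (by simpa using h0)
    have e2 : s 2 = 1 := le_antisymm (h1 2) (by simpa using h3')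
    refine ⟨hz.1, e1, e2, hz.2, ?_⟩
    simpa [hz.1, hz.2, e1, e2] using this

namespace Slot

theorem unused_le (x : Slot) (i : Fin 4) : x.unused i ≤ x.service i := Nat.sub_le _ _

/-- A queue offered at most one service wastes it only if it was empty. -/
theorem queue_mul_unused {x : Slot} {i : Fin 4} (h : x.service i ≤ 1) :
    x.queue i * x.unused i = 0 := by
  unfold unused
  rcases Nat.eq_zero_or_pos (x.queue i) with hq | hq
  · simp [hq]
  · rw [Nat.sub_eq_zero_of_le (by omega), mul_zero]

theorem next_eq (x : Slot) (i : Fin 4) :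
    (x.next i : ℝ) = x.queue i + x.arrivals i - x.service i + x.unused i := by
  have : ((x.next i + x.service i : ℕ) : ℝ) = (x.queue i + x.arrivals i + x.unused i : ℕ) := by
    rw [x.next_add_service i]
  push_cast at this
  linarith

/-- The increment of a queue in a slot is at most `A + 1` in absolute value. -/
theorem increment_sq_le {x : Slot} {i : Fin 4} {A : ℕ} (h : x.service i ≤ 1)
    (hA : x.arrivals i ≤ A) :
    ((x.arrivals i : ℝ) - x.service i + x.unused i) ^ 2 ≤ ((A : ℝ) + 1) ^ 2 := by
  have h1 : (x.service i : ℝ) ≤ 1 := by exact_mod_cast h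
  have h2 : (x.arrivals i : ℝ) ≤ A := by exact_mod_cast hA
  have h3 : (x.unused i : ℝ) ≤ x.service i := by exact_mod_cast x.unused_le i
  refine sq_le_sq' ?_ ?_
  · have : (0 : ℝ) ≤ x.arrivals i := Nat.cast_nonneg _
    have : (0 : ℝ) ≤ x.unused i := Nat.cast_nonneg _
    have : (0 : ℝ) ≤ A := Nat.cast_nonneg _
    linarith
  · linarith

end Slot

theorem IsMaxWeight.service_le_one {q s : Vec} (h : IsMaxWeight q s) (i : Fin 4) : s i ≤ 1 :=
  h.1.1.1 i

/-! ### Distance to a set as a Lyapunov function -/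

/-- Queue lengths as a vector of the Euclidean space. -/
noncomputable def toEuclidean (q : Vec) : EuclideanSpace ℝ (Fin 4) :=
  WithLp.toLp 2 fun i => (q i : ℝ)

@[simp] theorem toEuclidean_apply (q : Vec) (i : Fin 4) : toEuclidean q i = q i := rfl

theorem dist_toEuclidean_sq (q : Vec) (y : EuclideanSpace ℝ (Fin 4)) :
    dist (toEuclidean q) y ^ 2 = ∑ i, ((q i : ℝ) - y i) ^ 2 := by
  rw [EuclideanSpace.dist_sq_eq]
  simp [Real.dist_eq, sq_abs]

theorem abs_sub_le_dist_toEuclidean (q : Vec) (y : EuclideanSpace ℝ (Fin 4)) (i : Fin 4) :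
    |(q i : ℝ) - y i| ≤ dist (toEuclidean q) y := by
  rw [dist_eq_norm]
  exact PiLp.norm_apply_le (toEuclidean q - y) i

/-- Increment of the squared distance to a point of the nonnegative orthant in one slot. -/
theorem dist_next_sq_le {x : Slot} {A : ℕ} (hs : ∀ i, x.service i ≤ 1)
    (hA : ∀ i, x.arrivals i ≤ A) {y : EuclideanSpace ℝ (Fin 4)} (hy : ∀ i, 0 ≤ y i) :
    dist (toEuclidean x.next) y ^ 2 ≤ dist (toEuclidean x.queue) y ^ 2
      + (2 * ∑ i, ((x.queue i : ℝ) - y i) * ((x.arrivals i : ℝ) - x.service i)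
        + 4 * ((A : ℝ) + 1) ^ 2) := by
  -- Unused service can only help: in the expansion it enters linearly through `(q i - y i) * u i =
  -- -y i * u i ≤ 0`. The square of the whole increment is bounded by `(A + 1) ^ 2`.
  have h : ∀ i, ((x.next i : ℝ) - y i) ^ 2 ≤ ((x.queue i : ℝ) - y i) ^ 2
      + 2 * (((x.queue i : ℝ) - y i) * ((x.arrivals i : ℝ) - x.service i))
      + ((A : ℝ) + 1) ^ 2 := by
    intro i
    have h1 := Slot.increment_sq_le (hs i) (hA i)
    have h2 : (x.queue i : ℝ) * x.unused i = 0 := by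
      exact_mod_cast Slot.queue_mul_unused (hs i)
    have h3 : 0 ≤ y i * x.unused i := mul_nonneg (hy i) (Nat.cast_nonneg _)
    rw [x.next_eq i]
    nlinarith
  rw [dist_toEuclidean_sq, dist_toEuclidean_sq]
  simp only [Fin.sum_univ_four]
  linarith [h 0, h 1, h 2, h 3]

theorem IsSteadySlot.service_le_one {μ : Measure Slot} {lam var : Fin 4 → ℝ} {A : ℕ}
    (hμ : IsSteadySlot μ lam var A) : ∀ᵐ x ∂μ, ∀ i, x.service i ≤ 1 := by
  filter_upwards [hμ.maxWeight] with x hx i using hx.service_le_one i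

theorem IsSteadySlot.integrable_mul_arrivals {μ : Measure Slot} {lam var : Fin 4 → ℝ} {A : ℕ}
    (hμ : IsSteadySlot μ lam var A) {f : Slot → ℝ} (hf : Integrable f μ) (i : Fin 4) :
    Integrable (fun x => f x * (x.arrivals i : ℝ)) μ := by
  refine hf.mul_bdd (c := (A : ℝ)) (Measurable.of_discrete).aestronglyMeasurable ?_
  filter_upwards [hμ.arrivals_le] with x hx
  rw [Real.norm_of_nonneg (Nat.cast_nonneg _)]
  exact_mod_cast hx i

theorem IsSteadySlot.integral_mul_arrivals_sub {μ : Measure Slot} {lam var : Fin 4 → ℝ}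
    {A : ℕ} (hμ : IsSteadySlot μ lam var A) {h : Vec → ℝ}
    (hh : Integrable (fun x => h x.queue) μ) (i : Fin 4) :
    ∫ x, h x.queue * ((x.arrivals i : ℝ) - lam i) ∂μ = 0 := by
  simp only [mul_sub]
  rw [integral_sub (hμ.integrable_mul_arrivals hh i) (hh.mul_const _),
    hμ.integral_mul_arrivals, integral_mul_const, sub_self]

/-- Third moment of the distance of the queue lengths to a closed subset of the nonnegative
orthant towards which the system drifts. -/
theorem IsSteadySlot.integrable_infDist_cube {μ : Measure Slot} [IsProbabilityMeasure μ]
    {lam var : Fin 4 → ℝ} {A : ℕ} (hμ : IsSteadySlot μ lam var A)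
    {K : Set (EuclideanSpace ℝ (Fin 4))} (hK : IsClosed K) (hne : K.Nonempty)
    (hpos : ∀ y ∈ K, ∀ i, 0 ≤ y i) {c : ℝ} (hc : 0 < c)
    (hdrift : ∀ q s, IsMaxWeight q s → ∀ y ∈ K,
      Metric.infDist (toEuclidean q) K = dist (toEuclidean q) y →
      ∑ i, ((q i : ℝ) - y i) * (lam i - s i) ≤ -c * Metric.infDist (toEuclidean q) K) :
    Integrable (fun x => Metric.infDist (toEuclidean x.queue) K ^ 3) μ ∧
      ∫ x, Metric.infDist (toEuclidean x.queue) K ^ 3 ∂μ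
        ≤ driftConst (2 * c) (8 * ((A : ℝ) + 1) ^ 2) / (2 * c) := by
  -- `y q` is a nearest point of `K`. The next state is compared with this same point, which bounds
  -- its distance to `K` from above.
  choose y hyK hy using fun q => hK.exists_infDist_eq_dist hne (toEuclidean q)
  have hA0 : (0 : ℝ) ≤ A := Nat.cast_nonneg A
  have hD0 : ∀ q, 0 ≤ Metric.infDist (toEuclidean q) K := fun q => Metric.infDist_nonneg
  have habs : ∀ q i, |(q i : ℝ) - y q i| ≤ Metric.infDist (toEuclidean q) K := fun q i => by
    rw [hy q]
    exact abs_sub_le_dist_toEuclidean q (y q) i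
  refine integrable_cube_of_drift hμ.map_next (D := fun q => Metric.infDist (toEuclidean q) K)
    hD0 (Y := fun x => 2 * ∑ i, ((x.queue i : ℝ) - y x.queue i)
      * ((x.arrivals i : ℝ) - x.service i) + 4 * ((A : ℝ) + 1) ^ 2)
    (by positivity) (by positivity) ?_ ?_ ?_
  · filter_upwards [hμ.service_le_one, hμ.arrivals_le] with x h1 h2
    have h3 := dist_next_sq_le h1 h2 (hpos _ (hyK x.queue))
    rw [← hy] at h3
    refine le_trans (pow_le_pow_left₀ (hD0 _) (Metric.infDist_le_dist_of_mem (hyK x.queue)) 2) h3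
  · filter_upwards [hμ.service_le_one, hμ.arrivals_le] with x h1 h2
    have h3 : ∀ i, |((x.queue i : ℝ) - y x.queue i) * ((x.arrivals i : ℝ) - x.service i)|
        ≤ Metric.infDist (toEuclidean x.queue) K * (A + 1) := by
      intro i
      have h4 : (x.service i : ℝ) ≤ 1 := by exact_mod_cast h1 i
      have h5 : (x.arrivals i : ℝ) ≤ A := by exact_mod_cast h2 i
      have h6 : |(x.arrivals i : ℝ) - x.service i| ≤ A + 1 := by
        have : (0 : ℝ) ≤ x.arrivals i := Nat.cast_nonneg _
        have : (0 : ℝ) ≤ x.service i := Nat.cast_nonneg _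
        rw [abs_le]
        constructor <;> linarith
      rw [abs_mul]
      exact mul_le_mul (habs _ _) h6 (abs_nonneg _) (hD0 _)
    have h4 : |2 * ∑ i, ((x.queue i : ℝ) - y x.queue i) * ((x.arrivals i : ℝ) - x.service i)|
        ≤ 8 * (Metric.infDist (toEuclidean x.queue) K * (A + 1)) := by
      rw [abs_mul, abs_two, show (8 : ℝ) = 2 * 4 by norm_num, mul_assoc]
      gcongr
      refine (Finset.abs_sum_le_sum_abs _ _).trans ((Finset.sum_le_sum fun i _ => h3 i).trans ?_)
      simp
    refine (abs_add_le _ _).trans ?_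
    rw [abs_of_nonneg (a := 4 * ((A : ℝ) + 1) ^ 2) (by positivity)]
    have h5 := hD0 x.queue
    nlinarith [mul_nonneg h5 hA0, mul_nonneg (mul_nonneg h5 hA0) hA0]
  · rintro h hh ⟨R, hR⟩
    have hh1 : Integrable (fun x => h x.queue) μ := by
      refine Integrable.of_bound (Measurable.of_discrete).aestronglyMeasurable R
        (ae_of_all _ fun x => ?_)
      rw [Real.norm_of_nonneg (hh _)]
      nlinarith [hR x.queue, mul_nonneg (hh x.queue) (hD0 x.queue)]
    have hhD : ∀ f : Slot → ℝ, (∀ᵐ x ∂μ, |f x| ≤ Metric.infDist (toEuclidean x.queue) K) →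
        Integrable (fun x => h x.queue * f x) μ := by
      intro f hf
      refine Integrable.of_bound (Measurable.of_discrete).aestronglyMeasurable R ?_
      filter_upwards [hf] with x hx
      rw [norm_mul, Real.norm_of_nonneg (hh _), Real.norm_eq_abs]
      nlinarith [hR x.queue, mul_le_mul_of_nonneg_left hx (hh x.queue), hh x.queue]
    have hqy : ∀ i, Integrable (fun x => h x.queue * ((x.queue i : ℝ) - y x.queue i)) μ :=
      fun i => hhD _ (ae_of_all _ fun x => habs _ i)
    have hz : ∀ i, ∫ x, h x.queue * ((x.queue i : ℝ) - y x.queue i)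
        * ((x.arrivals i : ℝ) - lam i) ∂μ = 0 := fun i =>
      hμ.integral_mul_arrivals_sub (h := fun q => h q * ((q i : ℝ) - y q i)) (hqy i) i
    have hzi : ∀ i, Integrable (fun x => h x.queue * ((x.queue i : ℝ) - y x.queue i)
        * ((x.arrivals i : ℝ) - lam i)) μ := fun i => by
      simp only [mul_sub (h _ * _)]
      exact (hμ.integrable_mul_arrivals (hqy i) i).sub ((hqy i).mul_const _)
    have hsum : Integrable (fun x => ∑ i, 2 * (h x.queue * ((x.queue i : ℝ) - y x.queue i)
        * ((x.arrivals i : ℝ) - lam i))) μ :=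
      integrable_finsetSum _ fun i _ => (hzi i).const_mul 2
    have hsum0 : ∫ x, ∑ i, 2 * (h x.queue * ((x.queue i : ℝ) - y x.queue i)
        * ((x.arrivals i : ℝ) - lam i)) ∂μ = 0 := by
      rw [integral_finsetSum _ fun i _ => (hzi i).const_mul 2]
      refine Finset.sum_eq_zero fun i _ => ?_
      rw [integral_const_mul, hz i, mul_zero]
    have hr : Integrable (fun x => h x.queue * (-(2 * c)
        * Metric.infDist (toEuclidean x.queue) K + 8 * ((A : ℝ) + 1) ^ 2)) μ := by
      have := ((hhD (fun x => Metric.infDist (toEuclidean x.queue) K)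
        (ae_of_all _ fun x => (abs_of_nonneg (hD0 _)).le)).const_mul (-(2 * c))).add
        (hh1.mul_const (8 * ((A : ℝ) + 1) ^ 2))
      refine this.congr (ae_of_all _ fun x => ?_)
      simp only [Pi.add_apply]
      ring
    have hl : Integrable (fun x => h x.queue * (2 * ∑ i, ((x.queue i : ℝ) - y x.queue i)
        * ((x.arrivals i : ℝ) - x.service i) + 4 * ((A : ℝ) + 1) ^ 2)) μ := by
      have hs : ∀ i, Integrable (fun x => h x.queue * ((x.queue i : ℝ) - y x.queue i)
          * (x.service i : ℝ)) μ := fun i => by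
        refine (hqy i).mul_bdd (c := 1) (Measurable.of_discrete).aestronglyMeasurable ?_
        filter_upwards [hμ.service_le_one] with x hx
        rw [Real.norm_of_nonneg (Nat.cast_nonneg _)]
        exact_mod_cast hx i
      have := ((integrable_finsetSum Finset.univ fun i _ =>
        ((hμ.integrable_mul_arrivals (hqy i) i).sub (hs i))).const_mul 2).add
        (hh1.mul_const (4 * ((A : ℝ) + 1) ^ 2))
      refine this.congr (ae_of_all _ fun x => ?_)
      simp only [Pi.add_apply, Pi.sub_apply, Fin.sum_univ_four]
      ring
    -- Adding the mean-zero terms in `a - lam` to the right side reduces the claim to a pointwise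
    -- inequality in which arrivals are replaced by their means; that inequality is twice `hdrift`.
    rw [← zero_add (∫ x, h x.queue * (-(2 * c) * _ + _) ∂μ), ← hsum0, ← integral_add hsum hr]
    refine integral_mono_ae hl (hsum.add hr) ?_
    filter_upwards [hμ.maxWeight] with x hx
    have h1 := hdrift _ _ hx (y x.queue) (hyK _) (hy _)
    have h2 := hh x.queue
    have h3 := mul_le_mul_of_nonneg_left h1 h2
    have h4 : 0 ≤ h x.queue * ((A : ℝ) + 1) ^ 2 := by positivity
    simp only [Fin.sum_univ_four] at h3 ⊢
    nlinarith

/-! ### Finite moments and state space collapse -/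

/-- Positive arrival rates (bounded below by `m`) of a completely saturated switch. -/
structure IsSaturated (ν : Fin 4 → ℝ) (m : ℝ) : Prop where
  pos : 0 < m
  le : ∀ i, m ≤ ν i
  row : ν 0 + ν 1 = 1
  col : ν 0 + ν 2 = 1
  diag : ν 3 = ν 0

/-- Difference of the weights of the two perfect matchings. -/
def imbalance (q : Fin 4 → ℝ) : ℝ := q 0 + q 3 - q 1 - q 2

/-- Here `ν` is `ν 0` times the diagonal matching plus `1 - ν 0` times the other. The heavier
matching therefore beats `ν` by the weight difference times the coefficient of the lighter one,
which is at least `m`. -/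
theorem IsMaxWeight.drift_le {q s : Vec} (h : IsMaxWeight q s) {ν : Fin 4 → ℝ} {m : ℝ}
    (hν : IsSaturated ν m) :
    ∑ i, (q i : ℝ) * (ν i - s i) ≤ -m * |imbalance fun i => (q i : ℝ)| := by
  have h0 := hν.le 0
  have h1 := hν.le 1
  have e1 : ν 1 = 1 - ν 0 := by linarith [hν.row]
  have e2 : ν 2 = 1 - ν 0 := by linarith [hν.col]
  have e3 := hν.diag
  have hm := hν.pos
  simp only [Fin.sum_univ_four, imbalance]
  rcases h.cases with ⟨s0, s1, s2, s3, hw⟩ | ⟨s0, s1, s2, s3, hw⟩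
  · have hw' : (q 1 : ℝ) + q 2 ≤ q 0 + q 3 := by exact_mod_cast hw
    rw [abs_of_nonneg (by linarith), s0, s1, s2, s3, e1, e2, e3]
    push_cast
    nlinarith
  · have hw' : (q 0 : ℝ) + q 3 ≤ q 1 + q 2 := by exact_mod_cast hw
    rw [abs_of_nonpos (by linarith), s0, s1, s2, s3, e1, e2, e3]
    push_cast
    nlinarith

theorem norm_toEuclidean_le_sum (q : Vec) : ‖toEuclidean q‖ ≤ ∑ i, (q i : ℝ) := by
  refine le_of_sq_le_sq ?_ (Finset.sum_nonneg fun i _ => Nat.cast_nonneg _)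
  have := dist_toEuclidean_sq q 0
  rw [dist_zero_right] at this
  rw [this]
  simp only [Fin.sum_univ_four, PiLp.zero_apply, sub_zero]
  have h : ∀ i, (0 : ℝ) ≤ q i := fun i => Nat.cast_nonneg _
  nlinarith [mul_nonneg (h 0) (h 1), mul_nonneg (h 0) (h 2), mul_nonneg (h 0) (h 3),
    mul_nonneg (h 1) (h 2), mul_nonneg (h 1) (h 3), mul_nonneg (h 2) (h 3)]

section Moments

variable {μ : Measure Slot} [IsProbabilityMeasure μ] {ν var : Fin 4 → ℝ} {m ε : ℝ} {A : ℕ}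

/-- Case `K = {0}` of the moment bound: MaxWeight serves `q` at least as well as `ν` does, and the
slack `ε ν` leaves a drift of at most `-ε m ‖q‖`. The resulting bound is not uniform in `ε`, so only
finiteness is kept. -/
theorem IsSteadySlot.integrable_norm_sq
    (hμ : IsSteadySlot μ (fun i => (1 - ε) * ν i) var A) (hν : IsSaturated ν m) (hε : 0 < ε) :
    Integrable (fun x => ‖toEuclidean x.queue‖ ^ 2) μ := by
  have h := (hμ.integrable_infDist_cube (K := {0}) isClosed_singleton
    (Set.singleton_nonempty 0) (by simp) (mul_pos hε hν.pos) ?_).1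
  · simp only [Metric.infDist_singleton, dist_zero_right] at h
    refine (h.add (integrable_const 1)).mono (Measurable.of_discrete).aestronglyMeasurable
      (ae_of_all _ fun x => ?_)
    have h0 := norm_nonneg (toEuclidean x.queue)
    simp only [Pi.add_apply]
    rw [Real.norm_of_nonneg (by positivity), Real.norm_of_nonneg (by positivity)]
    nlinarith [mul_nonneg h0 (sq_nonneg (‖toEuclidean x.queue‖ - 1)), sq_nonneg (‖toEuclidean x.queue‖ - 1)]
  · intro q s hs y hy _
    rw [Set.mem_singleton_iff] at hy
    subst hy
    have h1 := hs.drift_le hν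
    have h2 := norm_toEuclidean_le_sum q
    rw [Metric.infDist_singleton, dist_zero_right]
    have h3 : m * ∑ i, (q i : ℝ) ≤ ∑ i, (q i : ℝ) * ν i := by
      rw [Finset.mul_sum]
      refine Finset.sum_le_sum fun i _ => ?_
      rw [mul_comm]
      exact mul_le_mul_of_nonneg_left (hν.le i) (Nat.cast_nonneg _)
    have h4 : ∑ i, ((q i : ℝ) - (0 : EuclideanSpace ℝ (Fin 4)) i) * ((1 - ε) * ν i - s i)
        = ∑ i, (q i : ℝ) * (ν i - s i) - ε * ∑ i, (q i : ℝ) * ν i := by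
      rw [Finset.mul_sum, ← Finset.sum_sub_distrib]
      refine Finset.sum_congr rfl fun i _ => ?_
      simp only [PiLp.zero_apply]
      ring
    rw [h4]
    have h5 := mul_nonneg hν.pos.le (abs_nonneg (imbalance fun i => (q i : ℝ)))
    have h6 := mul_le_mul_of_nonneg_left h2 hν.pos.le
    have h7 := mul_le_mul_of_nonneg_left (h6.trans h3) hε.le
    linarith

theorem IsSteadySlot.integrable_queue_mul
    (hμ : IsSteadySlot μ (fun i => (1 - ε) * ν i) var A) (hν : IsSaturated ν m) (hε : 0 < ε)
    (i j : Fin 4) : Integrable (fun x => (x.queue i : ℝ) * x.queue j) μ := by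
  refine (hμ.integrable_norm_sq hν hε).mono (Measurable.of_discrete).aestronglyMeasurable
    (ae_of_all _ fun x => ?_)
  have h : ∀ i, ‖(x.queue i : ℝ)‖ ≤ ‖toEuclidean x.queue‖ := fun i =>
    PiLp.norm_apply_le (toEuclidean x.queue) i
  rw [norm_mul, norm_pow, norm_norm, sq]
  exact mul_le_mul (h i) (h j) (norm_nonneg _) (norm_nonneg _)

theorem IsSteadySlot.integrable_queue
    (hμ : IsSteadySlot μ (fun i => (1 - ε) * ν i) var A) (hν : IsSaturated ν m) (hε : 0 < ε)
    (i : Fin 4) : Integrable (fun x => (x.queue i : ℝ)) μ := by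
  refine (hμ.integrable_queue_mul hν hε i i).mono (Measurable.of_discrete).aestronglyMeasurable
    (ae_of_all _ fun x => ?_)
  rw [Real.norm_of_nonneg (by positivity), Real.norm_of_nonneg (by positivity)]
  exact_mod_cast Nat.le_mul_self _

/-- Nonnegative vectors for which both perfect matchings have the same weight. -/
def balancedCone : Set (EuclideanSpace ℝ (Fin 4)) :=
  {y | (∀ i, 0 ≤ y i) ∧ imbalance y = 0}

theorem isClosed_balancedCone : IsClosed balancedCone := by
  have h : ∀ i : Fin 4, Continuous fun y : EuclideanSpace ℝ (Fin 4) => y i := fun i => by fun_prop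
  simp only [balancedCone, imbalance, Set.ofPred_and, Set.ofPred_forall]
  exact (isClosed_iInter fun i => isClosed_le continuous_const (h i)).inter
    (isClosed_eq (by fun_prop) continuous_const)

theorem zero_mem_balancedCone : (0 : EuclideanSpace ℝ (Fin 4)) ∈ balancedCone := by
  simp [balancedCone, imbalance]

/-- Raising one queue of the lighter matching by the weight difference balances the two matchings
and stays in the orthant. -/
theorem infDist_balancedCone_le (q : Vec) :
    Metric.infDist (toEuclidean q) balancedCone ≤ |imbalance fun i => (q i : ℝ)| := by
  have h0 : ∀ i, (0 : ℝ) ≤ q i := fun i => Nat.cast_nonneg _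
  rcases le_total 0 (imbalance fun i => (q i : ℝ)) with h | h
  · have hmem : !₂[(q 0 : ℝ), q 1 + imbalance fun i => (q i : ℝ), (q 2 : ℝ), (q 3 : ℝ)]
        ∈ balancedCone := by
      refine ⟨fun i => ?_, by simp [imbalance]; ring⟩
      have := h0 i
      fin_cases i <;> simp
      linarith [h0 1]
    refine (Metric.infDist_le_dist_of_mem hmem).trans (le_of_sq_le_sq ?_ (abs_nonneg _))
    rw [dist_toEuclidean_sq, sq_abs]
    simp [Fin.sum_univ_four]
  · have hmem : !₂[(q 0 : ℝ) - imbalance fun i => (q i : ℝ), (q 1 : ℝ), (q 2 : ℝ), (q 3 : ℝ)]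
        ∈ balancedCone := by
      refine ⟨fun i => ?_, by simp [imbalance]; ring⟩
      have := h0 i
      fin_cases i <;> simp
      linarith [h0 0]
    refine (Metric.infDist_le_dist_of_mem hmem).trans (le_of_sq_le_sq ?_ (abs_nonneg _))
    rw [dist_toEuclidean_sq, sq_abs]
    simp [Fin.sum_univ_four]

/-- The imbalance vanishes at the nearest point of the cone, and each of its four coordinates
differs from that of `q` by at most the distance. -/
theorem abs_imbalance_le (q : Vec) :
    |imbalance fun i => (q i : ℝ)| ≤ 4 * Metric.infDist (toEuclidean q) balancedCone := by
  obtain ⟨y, hy, hd⟩ := isClosed_balancedCone.exists_infDist_eq_dist ⟨0, zero_mem_balancedCone⟩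
    (toEuclidean q)
  have h := fun i => abs_le.1 (abs_sub_le_dist_toEuclidean q y i)
  have hy0 := hy.2
  rw [hd]
  simp only [imbalance] at hy0 ⊢
  rw [abs_le]
  constructor <;> linarith [(h 0).1, (h 1).1, (h 2).1, (h 3).1, (h 0).2, (h 1).2, (h 2).2, (h 3).2]

/-- State space collapse: the second moment of the imbalance is bounded uniformly in `ε`. -/
theorem IsSteadySlot.integral_imbalance_sq_le
    (hμ : IsSteadySlot μ (fun i => (1 - ε) * ν i) var A) (hν : IsSaturated ν m) (hε : 0 < ε)
    (hεm : ε ≤ m / 8) :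
    Integrable (fun x => (imbalance fun i => (x.queue i : ℝ)) ^ 2) μ ∧
    ∫ x, (imbalance fun i => (x.queue i : ℝ)) ^ 2 ∂μ
      ≤ 16 * (1 + driftConst m (8 * ((A : ℝ) + 1) ^ 2) / m) := by
  have hm := hν.pos
  -- The collapse drift is `-m D`, and the slack costs at most `4 ε D`; `ε ≤ m / 8` makes this at
  -- most `m D / 2`, leaving the rate `m / 2`.
  have h := hμ.integrable_infDist_cube (K := balancedCone) isClosed_balancedCone
    ⟨0, zero_mem_balancedCone⟩ (fun y hy => hy.1) (c := m / 2) (by positivity) ?_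
  · rw [mul_div_cancel₀ m two_ne_zero] at h
    have hle : ∀ x : Slot, (imbalance fun i => (x.queue i : ℝ)) ^ 2
        ≤ 16 * (1 + Metric.infDist (toEuclidean x.queue) balancedCone ^ 3) := by
      intro x
      have h1 := abs_imbalance_le x.queue
      have h0 : 0 ≤ Metric.infDist (toEuclidean x.queue) balancedCone := Metric.infDist_nonneg
      have h2 := pow_le_pow_left₀ (abs_nonneg _) h1 2
      rw [sq_abs] at h2
      nlinarith [mul_nonneg h0 (sq_nonneg (Metric.infDist (toEuclidean x.queue) balancedCone - 1)),
        sq_nonneg (Metric.infDist (toEuclidean x.queue) balancedCone - 1)]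
    have hi := ((integrable_const (μ := μ) (1 : ℝ)).add h.1).const_mul 16
    have hi2 : Integrable (fun x => (imbalance fun i => (x.queue i : ℝ)) ^ 2) μ := by
      refine hi.mono (Measurable.of_discrete).aestronglyMeasurable (ae_of_all _ fun x => ?_)
      rw [Real.norm_of_nonneg (sq_nonneg _)]
      exact (hle x).trans (le_abs_self _)
    refine ⟨hi2, (integral_mono hi2 hi hle).trans ?_⟩
    simp only [Pi.add_apply]
    rw [integral_const_mul, integral_add (integrable_const _) h.1]
    simp only [integral_const, probReal_univ, smul_eq_mul, one_mul]
    linarith [h.2]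
  · intro q s hs y hy hd
    have h1 := hs.drift_le hν
    have h2 := infDist_balancedCone_le q
    have h3 := fun i => abs_le.1 (abs_sub_le_dist_toEuclidean q y i)
    rw [← hd] at h3
    have h0 : 0 ≤ Metric.infDist (toEuclidean q) balancedCone := Metric.infDist_nonneg
    set D := Metric.infDist (toEuclidean q) balancedCone
    have e1 : ν 1 = 1 - ν 0 := by linarith [hν.row]
    have e2 : ν 2 = 1 - ν 0 := by linarith [hν.col]
    have e3 := hν.diag
    have hy0 : y 3 = y 1 + y 2 - y 0 := by
      have := hy.2
      simp only [imbalance] at this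
      linarith
    -- At a point of the cone both matchings, hence also their convex combination `ν`, have the same
    -- weight.
    have h4 : ∑ i, y i * (ν i - s i) = 0 := by
      simp only [Fin.sum_univ_four]
      rcases hs.cases with ⟨s0, s1, s2, s3, -⟩ | ⟨s0, s1, s2, s3, -⟩ <;>
      · rw [s0, s1, s2, s3, e1, e2, e3, hy0]
        push_cast
        ring
    have h5 : -(4 * D) ≤ ∑ i, ((q i : ℝ) - y i) * ν i := by
      have h6 : ∀ i, -D ≤ ((q i : ℝ) - y i) * ν i := by
        intro i
        have h7 : ν i ≤ 1 := by
          have a0 := hν.le 0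
          have a1 := hν.le 1
          fin_cases i <;> simp <;> linarith
        have h8 : 0 ≤ ν i := hm.le.trans (hν.le i)
        nlinarith [h3 i]
      have : ∑ i : Fin 4, -D ≤ ∑ i, ((q i : ℝ) - y i) * ν i := Finset.sum_le_sum fun i _ => h6 i
      simp only [Finset.sum_const, Finset.card_univ, Fintype.card_fin, nsmul_eq_mul] at this
      push_cast at this
      linarith
    have h6 : ∑ i, ((q i : ℝ) - y i) * ((1 - ε) * ν i - s i)
        = ∑ i, (q i : ℝ) * (ν i - s i) - ∑ i, y i * (ν i - s i)
          - ε * ∑ i, ((q i : ℝ) - y i) * ν i := by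
      simp only [Fin.sum_univ_four]
      ring
    rw [h6, h4]
    nlinarith [mul_le_mul_of_nonneg_left h2 hm.le, mul_le_mul_of_nonneg_left h5 hε.le,
      mul_le_mul_of_nonneg_right hεm h0]

end Moments

/-! ### Steady-state drift identities -/

/-- `f` is integrable with integral `a`. -/
def HasMean (μ : Measure Slot) (f : Slot → ℝ) (a : ℝ) : Prop :=
  Integrable f μ ∧ ∫ x, f x ∂μ = a

namespace HasMean

variable {μ : Measure Slot} {f g : Slot → ℝ} {a b : ℝ}

theorem _root_.MeasureTheory.Integrable.hasMean (hf : Integrable f μ) :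
    HasMean μ f (∫ x, f x ∂μ) := ⟨hf, rfl⟩

theorem const [IsProbabilityMeasure μ] (a : ℝ) : HasMean μ (fun _ => a) a :=
  ⟨integrable_const _, by simp⟩

theorem add (hf : HasMean μ f a) (hg : HasMean μ g b) :
    HasMean μ (fun x => f x + g x) (a + b) :=
  ⟨hf.1.add hg.1, by rw [integral_add hf.1 hg.1, hf.2, hg.2]⟩

theorem sub (hf : HasMean μ f a) (hg : HasMean μ g b) :
    HasMean μ (fun x => f x - g x) (a - b) :=
  ⟨hf.1.sub hg.1, by rw [integral_sub hf.1 hg.1, hf.2, hg.2]⟩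

theorem const_mul (c : ℝ) (hf : HasMean μ f a) : HasMean μ (fun x => c * f x) (c * a) :=
  ⟨hf.1.const_mul c, by rw [integral_const_mul, hf.2]⟩

theorem sum (c : Fin 4 → ℝ) {f : Fin 4 → Slot → ℝ} {a : Fin 4 → ℝ}
    (hf : ∀ k, HasMean μ (f k) (a k)) : HasMean μ (fun x => ∑ k, c k * f k x) (∑ k, c k * a k) :=
  ⟨integrable_finsetSum _ fun k _ => (hf k).1.const_mul _, by
    rw [integral_finsetSum _ fun k _ => (hf k).1.const_mul (c k)]
    exact Finset.sum_congr rfl fun k _ => ((hf k).const_mul (c k)).2⟩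

theorem sum_mul_sum (b c : Fin 4 → ℝ) {f g : Fin 4 → Slot → ℝ} {a : Fin 4 → Fin 4 → ℝ}
    (hfg : ∀ k l, HasMean μ (fun x => f k x * g l x) (a k l)) :
    HasMean μ (fun x => (∑ k, b k * f k x) * ∑ l, c l * g l x)
      (∑ k, ∑ l, b k * c l * a k l) := by
  have h : ∀ x, (∑ k, b k * f k x) * ∑ l, c l * g l x
      = ∑ k, b k * ∑ l, c l * (f k x * g l x) := fun x => by
    rw [Finset.sum_mul]
    refine Finset.sum_congr rfl fun k _ => ?_
    rw [Finset.mul_sum, Finset.mul_sum]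
    exact Finset.sum_congr rfl fun l _ => by ring
  have h2 : ∑ k, ∑ l, b k * c l * a k l = ∑ k, b k * ∑ l, c l * a k l := by
    refine Finset.sum_congr rfl fun k _ => ?_
    rw [Finset.mul_sum]
    exact Finset.sum_congr rfl fun l _ => by ring
  simp only [h, h2]
  exact sum b fun k => sum c fun l => hfg k l

theorem le (hf : HasMean μ f a) (hg : HasMean μ g b) (h : ∀ᵐ x ∂μ, f x ≤ g x) : a ≤ b := by
  rw [← hf.2, ← hg.2]
  exact integral_mono_ae hf.1 hg.1 h

theorem eq (hf : HasMean μ f a) (hg : HasMean μ g b) (h : ∀ᵐ x ∂μ, f x = g x) : a = b := by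
  rw [← hf.2, ← hg.2]
  exact integral_congr_ae h

theorem next (hmap : μ.map Slot.next = μ.map Slot.queue) {f : Vec → ℝ}
    (hf : HasMean μ (fun x => f x.queue) a) : HasMean μ (fun x => f x.next) a :=
  ⟨(integrable_next_iff hmap f).2 hf.1, (integral_next_eq hmap f).trans hf.2⟩

end HasMean

section SteadyState

variable {μ : Measure Slot} [IsProbabilityMeasure μ] {ν var : Fin 4 → ℝ} {m ε : ℝ} {A : ℕ}

theorem IsSteadySlot.memLp_arrivals {lam : Fin 4 → ℝ} (hμ : IsSteadySlot μ lam var A)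
    (i : Fin 4) : MemLp (fun x => (x.arrivals i : ℝ)) 2 μ := by
  refine MemLp.of_bound (Measurable.of_discrete).aestronglyMeasurable (A : ℝ) ?_
  filter_upwards [hμ.arrivals_le] with x hx
  rw [Real.norm_of_nonneg (Nat.cast_nonneg _)]
  exact_mod_cast hx i

theorem IsSteadySlot.unused_le_one {lam : Fin 4 → ℝ} (hμ : IsSteadySlot μ lam var A) :
    ∀ᵐ x ∂μ, ∀ i, (x.unused i : ℝ) ≤ 1 := by
  filter_upwards [hμ.service_le_one] with x hx i
  exact_mod_cast (x.unused_le i).trans (hx i)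

theorem IsSteadySlot.memLp_unused {lam : Fin 4 → ℝ} (hμ : IsSteadySlot μ lam var A)
    (i : Fin 4) : MemLp (fun x => (x.unused i : ℝ)) 2 μ := by
  refine MemLp.of_bound (Measurable.of_discrete).aestronglyMeasurable 1 ?_
  filter_upwards [hμ.unused_le_one] with x hx
  rw [Real.norm_of_nonneg (Nat.cast_nonneg _)]
  exact hx i

theorem IsSteadySlot.memLp_queue
    (hμ : IsSteadySlot μ (fun i => (1 - ε) * ν i) var A) (hν : IsSaturated ν m) (hε : 0 < ε)
    (i : Fin 4) : MemLp (fun x => (x.queue i : ℝ)) 2 μ := by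
  rw [memLp_two_iff_integrable_sq (Measurable.of_discrete).aestronglyMeasurable]
  simpa only [sq] using hμ.integrable_queue_mul hν hε i i

theorem IsSteadySlot.memLp_next
    (hμ : IsSteadySlot μ (fun i => (1 - ε) * ν i) var A) (hν : IsSaturated ν m) (hε : 0 < ε)
    (i : Fin 4) : MemLp (fun x => (x.next i : ℝ)) 2 μ := by
  rw [memLp_two_iff_integrable_sq (Measurable.of_discrete).aestronglyMeasurable]
  have := (integrable_next_iff hμ.map_next fun q => (q i : ℝ) * q i).2
    (hμ.integrable_queue_mul hν hε i i)
  simpa only [sq] using this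

theorem IsSteadySlot.hasMean_arrivals_sub {lam : Fin 4 → ℝ} (hμ : IsSteadySlot μ lam var A)
    (i : Fin 4) : HasMean μ (fun x => (x.arrivals i : ℝ) - lam i) 0 :=
  ⟨((hμ.memLp_arrivals i).integrable one_le_two).sub (integrable_const _), by
    simpa using hμ.integral_mul_arrivals_sub (h := fun _ => 1) (integrable_const 1) i⟩

theorem IsSteadySlot.hasMean_queue_mul_arrivals_sub
    (hμ : IsSteadySlot μ (fun i => (1 - ε) * ν i) var A) (hν : IsSaturated ν m) (hε : 0 < ε)
    (i j : Fin 4) :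
    HasMean μ (fun x => (x.queue i : ℝ) * ((x.arrivals j : ℝ) - (1 - ε) * ν j)) 0 :=
  ⟨(hμ.memLp_queue hν hε i).integrable_mul ((hμ.memLp_arrivals j).sub (memLp_const _)),
    hμ.integral_mul_arrivals_sub (h := fun q => (q i : ℝ)) (hμ.integrable_queue hν hε i) j⟩

/-- A linear form that takes the same value `β` on both perfect matchings. -/
structure IsBalancedForm (b : Fin 4 → ℝ) (β : ℝ) : Prop where
  diag : b 0 + b 3 = β
  antidiag : b 1 + b 2 = β

theorem IsBalancedForm.service {b : Fin 4 → ℝ} {β : ℝ} (hb : IsBalancedForm b β) {q s : Vec}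
    (h : IsMaxWeight q s) : ∑ k, b k * (s k : ℝ) = β := by
  simp only [Fin.sum_univ_four]
  rcases h.cases with ⟨s0, s1, s2, s3, -⟩ | ⟨s0, s1, s2, s3, -⟩
  · rw [s0, s1, s2, s3, ← hb.diag]; push_cast; ring
  · rw [s0, s1, s2, s3, ← hb.antidiag]; push_cast; ring

theorem IsBalancedForm.rates {b : Fin 4 → ℝ} {β : ℝ} (hb : IsBalancedForm b β)
    (hν : IsSaturated ν m) : ∑ k, b k * ν k = β := by
  have e1 : ν 1 = 1 - ν 0 := by linarith [hν.row]
  have e2 : ν 2 = 1 - ν 0 := by linarith [hν.col]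
  simp only [Fin.sum_univ_four]
  rw [e1, e2, hν.diag]
  linear_combination ν 0 * hb.diag + (1 - ν 0) * hb.antidiag

/-- The schedule contributes the constant `β` and the mean arrivals contribute `(1 - ε) * β`, so the
policy drops out and only `-ε * β` remains. -/
theorem IsBalancedForm.next {b : Fin 4 → ℝ} {β : ℝ} (hb : IsBalancedForm b β)
    (hν : IsSaturated ν m) {x : Slot} (h : IsMaxWeight x.queue x.service) (ε : ℝ) :
    ∑ k, b k * (x.next k : ℝ) = ∑ k, b k * (x.queue k : ℝ)
      + (∑ k, b k * ((x.arrivals k : ℝ) - (1 - ε) * ν k) - ε * β) + ∑ k, b k * (x.unused k : ℝ) := by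
  have h1 := hb.service h
  have h2 := hb.rates hν
  simp only [x.next_eq]
  simp only [Fin.sum_univ_four] at h1 h2 ⊢
  linear_combination (-1) * h1 + (1 - ε) * h2

/-- The drift of a balanced linear form vanishes in steady state. -/
theorem IsSteadySlot.linear_drift
    (hμ : IsSteadySlot μ (fun i => (1 - ε) * ν i) var A) (hν : IsSaturated ν m) (hε : 0 < ε)
    {b : Fin 4 → ℝ} {β : ℝ} (hb : IsBalancedForm b β) :
    ∑ k, b k * ∫ x, (x.unused k : ℝ) ∂μ = ε * β := by
  have hq := HasMean.sum b fun k => (hμ.integrable_queue hν hε k).hasMean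
  have hu := HasMean.sum b fun k => ((hμ.memLp_unused k).integrable one_le_two).hasMean
  have ha := HasMean.sum b fun k => hμ.hasMean_arrivals_sub k
  have h := (hq.next (f := fun q => ∑ k, b k * (q k : ℝ)) hμ.map_next).eq
    ((hq.add (ha.sub (.const (ε * β)))).add hu)
    (by filter_upwards [hμ.maxWeight] with x hx using hb.next hν hx ε)
  simp only [mul_zero, Finset.sum_const_zero] at h
  linarith

/-- The drift of a product of two balanced linear forms vanishes in steady state. -/
theorem IsSteadySlot.quadratic_drift
    (hμ : IsSteadySlot μ (fun i => (1 - ε) * ν i) var A) (hν : IsSaturated ν m) (hε : 0 < ε)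
    {b c : Fin 4 → ℝ} {β γ : ℝ} (hb : IsBalancedForm b β) (hc : IsBalancedForm c γ) :
    ε * γ * ∑ k, b k * ∫ x, (x.queue k : ℝ) ∂μ + ε * β * ∑ k, c k * ∫ x, (x.queue k : ℝ) ∂μ
      = ∑ k, ∑ l, (b k * c l + c k * b l) * ∫ x, (x.next k : ℝ) * (x.unused l : ℝ) ∂μ
        - ∑ k, ∑ l, b k * c l * ∫ x, (x.unused k : ℝ) * (x.unused l : ℝ) ∂μ
        + ∑ k, b k * c k * var k + ε ^ 2 * β * γ := by
  have Lq := hμ.memLp_queue hν hε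
  have Ln := hμ.memLp_next hν hε
  have Lu := hμ.memLp_unused
  have La : ∀ k, MemLp (fun x => (x.arrivals k : ℝ) - (1 - ε) * ν k) 2 μ := fun k =>
    (hμ.memLp_arrivals k).sub (memLp_const _)
  have hprod : ∀ {f g : Slot → ℝ}, MemLp f 2 μ → MemLp g 2 μ →
      HasMean μ (fun x => f x * g x) (∫ x, f x * g x ∂μ) :=
    fun hf hg => (hf.integrable_mul hg).hasMean
  have hq := fun b : Fin 4 → ℝ => HasMean.sum b fun k => (hμ.integrable_queue hν hε k).hasMean
  have ha := fun b : Fin 4 → ℝ => HasMean.sum b fun k => hμ.hasMean_arrivals_sub k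
  have hqa := fun b c : Fin 4 → ℝ => HasMean.sum_mul_sum b c
    fun k l => hμ.hasMean_queue_mul_arrivals_sub hν hε k l
  have haa := HasMean.sum_mul_sum b c (a := fun k l => if k = l then var k else 0)
    fun k l => ⟨(La k).integrable_mul (La l), hμ.covariance k l⟩
  have hqq := HasMean.sum_mul_sum b c fun k l => hprod (Lq k) (Lq l)
  have hnn := hqq.next (f := fun q => (∑ k, b k * (q k : ℝ)) * ∑ k, c k * (q k : ℝ)) hμ.map_next
  have hnu := fun b c : Fin 4 → ℝ => HasMean.sum_mul_sum b c fun k l => hprod (Ln k) (Lu l)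
  have huu := HasMean.sum_mul_sum b c fun k l => hprod (Lu k) (Lu l)
  -- Unused service is first moved to the side of `q⁺`, so that after squaring it is paired with
  -- `q⁺`, for which `q⁺ i * u i = 0`. The means of the products of the forms in `q⁺` and in `q`
  -- then cancel by stationarity.
  have key := (((hnn.sub (hnu b c)).sub (hnu c b)).add huu).eq
    ((((((((hqq.add (hqa b c)).add (hqa c b)).add haa).add ((hq b).const_mul (-(ε * γ)))).add
      ((hq c).const_mul (-(ε * β)))).add ((ha b).const_mul (-(ε * γ)))).add
      ((ha c).const_mul (-(ε * β)))).add (.const (ε * β * (ε * γ)))) (by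
      filter_upwards [hμ.maxWeight] with x hx
      rw [hb.next hν hx ε, hc.next hν hx ε]
      ring)
  have hx : ∑ k, ∑ l, (b k * c l + c k * b l) * ∫ x, (x.next k : ℝ) * (x.unused l : ℝ) ∂μ
      = ∑ k, ∑ l, b k * c l * ∫ x, (x.next k : ℝ) * (x.unused l : ℝ) ∂μ
        + ∑ k, ∑ l, c k * b l * ∫ x, (x.next k : ℝ) * (x.unused l : ℝ) ∂μ := by
    simp only [add_mul, Finset.sum_add_distrib]
  simp only [mul_zero, Finset.sum_const_zero, mul_ite, Finset.sum_ite_eq, Finset.mem_univ,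
    if_true] at key
  rw [hx]
  linarith

/-- The linear drift of a row sum says that the mean unused services in that row add up to exactly
`ε`. -/
theorem IsSteadySlot.integral_unused_le
    (hμ : IsSteadySlot μ (fun i => (1 - ε) * ν i) var A) (hν : IsSaturated ν m) (hε : 0 < ε)
    (i : Fin 4) : ∫ x, (x.unused i : ℝ) ∂μ ≤ ε := by
  have h0 : ∀ k, 0 ≤ ∫ x, (x.unused k : ℝ) ∂μ := fun k =>
    integral_nonneg fun x => Nat.cast_nonneg _
  have h1 := hμ.linear_drift hν hε (b := ![1, 1, 0, 0]) (β := 1) ⟨by simp, by simp⟩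
  have h2 := hμ.linear_drift hν hε (b := ![0, 0, 1, 1]) (β := 1) ⟨by simp, by simp⟩
  simp only [Fin.sum_univ_four] at h1 h2
  simp at h1 h2
  fin_cases i <;> simp <;> linarith [h0 0, h0 1, h0 2, h0 3]

theorem IsSteadySlot.integral_unused_mul_unused_le
    (hμ : IsSteadySlot μ (fun i => (1 - ε) * ν i) var A) (hν : IsSaturated ν m) (hε : 0 < ε)
    (i j : Fin 4) : ∫ x, (x.unused i : ℝ) * (x.unused j : ℝ) ∂μ ≤ ε := by
  refine (integral_mono_ae ((hμ.memLp_unused i).integrable_mul (hμ.memLp_unused j))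
    ((hμ.memLp_unused i).integrable one_le_two) ?_).trans (hμ.integral_unused_le hν hε i)
  filter_upwards [hμ.unused_le_one] with x hx
  exact mul_le_of_le_one_right (Nat.cast_nonneg _) (hx j)

/-- Heavy-traffic scaling of the mean queue lengths. -/
theorem IsSteadySlot.scaled_mean_le
    (hμ : IsSteadySlot μ (fun i => (1 - ε) * ν i) var A) (hν : IsSaturated ν m) (hε : 0 < ε)
    (i : Fin 4) : ε * ∫ x, (x.queue i : ℝ) ∂μ ≤ 2 * ((A : ℝ) + 1) ^ 2 / m := by
  have hq := HasMean.sum ν fun k => (hμ.integrable_queue hν hε k).hasMean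
  have hqa := HasMean.sum (fun _ => 2) fun k => hμ.hasMean_queue_mul_arrivals_sub hν hε k k
  have hn2 := (hμ.integrable_norm_sq hν hε).hasMean
  -- In the drift of `‖q‖ ^ 2` the MaxWeight term is nonpositive and is dropped; what remains is `2
  -- ε ∑ ν k E[q k] ≤ 4 (A + 1) ^ 2`.
  have hle := (hn2.next (f := fun q => ‖toEuclidean q‖ ^ 2) hμ.map_next).le
    (((hn2.add hqa).sub (hq.const_mul (2 * ε))).add (.const (4 * ((A : ℝ) + 1) ^ 2))) (by
      filter_upwards [hμ.maxWeight, hμ.arrivals_le] with x h1 h2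
      have h3 := dist_next_sq_le h1.service_le_one h2 (y := 0) (fun i => le_rfl)
      have h4 := h1.drift_le hν
      have h5 := mul_nonneg hν.pos.le (abs_nonneg (imbalance fun i => (x.queue i : ℝ)))
      simp only [dist_zero_right, PiLp.zero_apply, sub_zero, Fin.sum_univ_four] at h3 h4 ⊢
      linarith)
  simp only [mul_zero, Finset.sum_const_zero] at hle
  have h0 : ∀ k, 0 ≤ ∫ x, (x.queue k : ℝ) ∂μ := fun k =>
    integral_nonneg fun x => Nat.cast_nonneg _
  have h1 : m * ∫ x, (x.queue i : ℝ) ∂μ ≤ ∑ k, ν k * ∫ x, (x.queue k : ℝ) ∂μ :=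
    (mul_le_mul_of_nonneg_right (hν.le i) (h0 i)).trans
      (Finset.single_le_sum (f := fun k => ν k * ∫ x, (x.queue k : ℝ) ∂μ)
        (fun k _ => mul_nonneg (hν.pos.le.trans (hν.le k)) (h0 k)) (Finset.mem_univ i))
  rw [le_div_iff₀ hν.pos]
  nlinarith [mul_le_mul_of_nonneg_left h1 hε.le]

end SteadyState

/-! ### Bounds on cross terms and on the imbalance -/

theorem abs_proj_le (q : Vec) (i : Fin 4) : |proj q i| ≤ ‖toEuclidean q‖ :=
  (PiLp.norm_apply_le (proj q) i).trans (collapseSpace.norm_starProjection_apply_le _)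

section SteadyState

variable {μ : Measure Slot} [IsProbabilityMeasure μ] {ν var : Fin 4 → ℝ} {m ε : ℝ} {A : ℕ}

theorem IsSteadySlot.integrable_monomial
    (hμ : IsSteadySlot μ (fun i => (1 - ε) * ν i) var A) (hν : IsSaturated ν m) (hε : 0 < ε)
    (i j : Fin 4) : Integrable (fun x => monomial i j x.queue) μ := by
  refine (hμ.integrable_norm_sq hν hε).mono (Measurable.of_discrete).aestronglyMeasurable
    (ae_of_all _ fun x => ?_)
  rw [monomial, norm_mul, norm_pow, norm_norm, sq]
  exact mul_le_mul (abs_proj_le _ i) (abs_proj_le _ j) (abs_nonneg _) (norm_nonneg _)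

theorem IsSteadySlot.hasMean_next_mul_unused
    (hμ : IsSteadySlot μ (fun i => (1 - ε) * ν i) var A) (hν : IsSaturated ν m) (hε : 0 < ε)
    (i j : Fin 4) : HasMean μ (fun x => (x.next i : ℝ) * (x.unused j : ℝ))
      (∫ x, (x.next i : ℝ) * (x.unused j : ℝ) ∂μ) :=
  ((hμ.memLp_next hν hε i).integrable_mul (hμ.memLp_unused j)).hasMean

theorem integral_next_mul_unused_self (i : Fin 4) :
    ∫ x, (x.next i : ℝ) * (x.unused i : ℝ) ∂μ = 0 := by
  have : ∀ x : Slot, (x.next i : ℝ) * (x.unused i : ℝ) = 0 := fun x => by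
    exact_mod_cast x.next_mul_unused i
  simp [this]

theorem integral_next_mul_unused_nonneg (i j : Fin 4) :
    0 ≤ ∫ x, (x.next i : ℝ) * (x.unused j : ℝ) ∂μ :=
  integral_nonneg fun x => by
    show (0 : ℝ) ≤ (x.next i : ℝ) * (x.unused j : ℝ)
    positivity

/-- Bound on the cross terms inside a balanced form. -/
theorem IsSteadySlot.sum_cross_le
    (hμ : IsSteadySlot μ (fun i => (1 - ε) * ν i) var A) (hν : IsSaturated ν m) (hε : 0 < ε)
    (hvar : ∀ k, 0 ≤ var k) {b : Fin 4 → ℝ} (hb : IsBalancedForm b 1) (hb0 : ∀ k, 0 ≤ b k) :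
    ∑ k, ∑ l, b k * b l * ∫ x, (x.next k : ℝ) * (x.unused l : ℝ) ∂μ
      ≤ 4 * (((A : ℝ) + 1) ^ 2 / m + ε) := by
  have h := hμ.quadratic_drift hν hε hb hb
  have hs : ∑ k, b k = 2 := by
    simp only [Fin.sum_univ_four]
    linarith [hb.diag, hb.antidiag]
  have h1 : ε * ∑ k, b k * ∫ x, (x.queue k : ℝ) ∂μ ≤ 2 * (2 * ((A : ℝ) + 1) ^ 2 / m) := by
    refine le_of_le_of_eq ?_ (congrArg (· * (2 * ((A : ℝ) + 1) ^ 2 / m)) hs)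
    rw [Finset.mul_sum, Finset.sum_mul]
    refine Finset.sum_le_sum fun k _ => ?_
    have := mul_le_mul_of_nonneg_left (hμ.scaled_mean_le hν hε k) (hb0 k)
    linarith
  have h2 : ∑ k, ∑ l, b k * b l * ∫ x, (x.unused k : ℝ) * (x.unused l : ℝ) ∂μ ≤ 2 * (2 * ε) := by
    conv_rhs => rw [← hs, Finset.sum_mul]
    refine Finset.sum_le_sum fun k _ => ?_
    rw [Finset.sum_mul, Finset.mul_sum]
    refine Finset.sum_le_sum fun l _ => ?_
    rw [mul_assoc]
    exact mul_le_mul_of_nonneg_left (mul_le_mul_of_nonneg_left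
      (hμ.integral_unused_mul_unused_le hν hε k l) (hb0 l)) (hb0 k)
  have h3 : 0 ≤ ∑ k, b k * b k * var k :=
    Finset.sum_nonneg fun k _ => mul_nonneg (mul_self_nonneg _) (hvar k)
  have h4 : ∑ k, ∑ l, (b k * b l + b k * b l) * ∫ x, (x.next k : ℝ) * (x.unused l : ℝ) ∂μ
      = 2 * ∑ k, ∑ l, b k * b l * ∫ x, (x.next k : ℝ) * (x.unused l : ℝ) ∂μ := by
    simp only [Finset.mul_sum]
    exact Finset.sum_congr rfl fun k _ => Finset.sum_congr rfl fun l _ => by ring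
  rw [h4] at h
  have h5 : 2 * (2 * ((A : ℝ) + 1) ^ 2 / m) = 4 * (((A : ℝ) + 1) ^ 2 / m) := by ring
  nlinarith [sq_nonneg ε]

/-- The cross terms of two queues that share a port are bounded. -/
theorem IsSteadySlot.cross_le
    (hμ : IsSteadySlot μ (fun i => (1 - ε) * ν i) var A) (hν : IsSaturated ν m) (hε : 0 < ε)
    (hvar : ∀ k, 0 ≤ var k) {i j : Fin 4} (hij : i ≠ j) (hij' : i + j ≠ 3) :
    ∫ x, (x.next i : ℝ) * (x.unused j : ℝ) ∂μ ≤ 4 * (((A : ℝ) + 1) ^ 2 / m + ε) := by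
  have h0 := fun k l => integral_next_mul_unused_nonneg (μ := μ) k l
  -- Two distinct indices lie on a common matching exactly when they sum to `3`; otherwise they form
  -- a port, which meets each matching once.
  have hb : IsBalancedForm (fun k => if k = i ∨ k = j then (1 : ℝ) else 0) 1 := by
    constructor <;> fin_cases i <;> fin_cases j <;> simp at hij hij' ⊢
  have h := hμ.sum_cross_le hν hε hvar hb fun k => by split_ifs <;> norm_num
  refine le_trans ?_ h
  have hnn : ∀ k l, (0 : ℝ) ≤ (if k = i ∨ k = j then (1 : ℝ) else 0)
      * (if l = i ∨ l = j then (1 : ℝ) else 0)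
      * ∫ x, (x.next k : ℝ) * (x.unused l : ℝ) ∂μ := fun k l =>
    mul_nonneg (by split_ifs <;> norm_num) (h0 k l)
  refine le_trans ?_ (Finset.single_le_sum (fun k _ => Finset.sum_nonneg fun l _ => hnn k l)
    (Finset.mem_univ i))
  refine le_trans ?_ (Finset.single_le_sum (fun l _ => hnn i l) (Finset.mem_univ j))
  simp

/-- Uniform bound on the second moment of the imbalance. -/
noncomputable def imbalanceConst (m : ℝ) (A : ℕ) : ℝ :=
  16 * (1 + driftConst m (8 * ((A : ℝ) + 1) ^ 2) / m)

theorem IsSteadySlot.abs_imbalance_queue_le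
    (hμ : IsSteadySlot μ (fun i => (1 - ε) * ν i) var A) (hν : IsSaturated ν m) (hε : 0 < ε)
    (hεm : ε ≤ m / 8) :
    |imbalance fun i => ∫ x, (x.queue i : ℝ) ∂μ| ≤ imbalanceConst m A + 1 := by
  have h2 := hμ.integral_imbalance_sq_le hν hε hεm
  have hq := fun i => (hμ.integrable_queue hν hε i).hasMean
  have hw : HasMean μ (fun x => imbalance fun i => (x.queue i : ℝ))
      (imbalance fun i => ∫ x, (x.queue i : ℝ) ∂μ) :=
    (((hq 0).add (hq 3)).sub (hq 1)).sub (hq 2)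
  have hr := h2.1.hasMean.add (HasMean.const (μ := μ) 1)
  have h3 := hw.le hr (ae_of_all _ fun x => by
    nlinarith [sq_nonneg ((imbalance fun i => (x.queue i : ℝ)) - 1)])
  have h4 := (hw.const_mul (-1)).le hr (ae_of_all _ fun x => by
    nlinarith [sq_nonneg ((imbalance fun i => (x.queue i : ℝ)) + 1)])
  have h5 : ∫ x, (imbalance fun i => (x.queue i : ℝ)) ^ 2 ∂μ ≤ imbalanceConst m A := h2.2
  rw [abs_le]
  constructor <;> linarith

/-- Cauchy-Schwarz in the form `2 t |W u| ≤ t ^ 2 W ^ 2 + u ^ 2` with `t = √ε`: the second moment of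
`W` is bounded, and `u ^ 2 ≤ u` has mean at most `ε`. -/
theorem IsSteadySlot.abs_imbalance_cross_le
    (hμ : IsSteadySlot μ (fun i => (1 - ε) * ν i) var A) (hν : IsSaturated ν m) (hε : 0 < ε)
    (hεm : ε ≤ m / 8) (j : Fin 4) :
    |imbalance fun i => ∫ x, (x.next i : ℝ) * (x.unused j : ℝ) ∂μ|
      ≤ √ε * (imbalanceConst m A + 1) := by
  have h2 := hμ.integral_imbalance_sq_le hν hε hεm
  have hx := fun i => hμ.hasMean_next_mul_unused hν hε i j
  have hw : HasMean μ (fun x => (imbalance fun i => (x.next i : ℝ)) * x.unused j)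
      (imbalance fun i => ∫ x, (x.next i : ℝ) * (x.unused j : ℝ) ∂μ) := by
    have := (((hx 0).add (hx 3)).sub (hx 1)).sub (hx 2)
    refine ⟨this.1.congr (ae_of_all _ fun x => ?_), ?_⟩
    · simp only [imbalance]; ring
    · rw [imbalance, ← this.2]
      refine integral_congr_ae (ae_of_all _ fun x => ?_)
      simp only [imbalance]; ring
  have hn := h2.1.hasMean.next (f := fun q => (imbalance fun i => (q i : ℝ)) ^ 2) hμ.map_next
  have hu := ((hμ.memLp_unused j).integrable one_le_two).hasMean
  have hr := (hn.const_mul ε).add hu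
  set t := √ε with ht
  have ht2 : t ^ 2 = ε := Real.sq_sqrt hε.le
  have ht0 : 0 < t := Real.sqrt_pos.2 hε
  have h3 := (hw.const_mul (2 * t)).le hr (by
    filter_upwards [hμ.unused_le_one] with x hx
    have h0 : (0 : ℝ) ≤ x.unused j := Nat.cast_nonneg _
    rw [← ht2]
    nlinarith [sq_nonneg (t * (imbalance fun i => (x.next i : ℝ)) - x.unused j), hx j])
  have h4 := (hw.const_mul (-(2 * t))).le hr (by
    filter_upwards [hμ.unused_le_one] with x hx
    have h0 : (0 : ℝ) ≤ x.unused j := Nat.cast_nonneg _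
    rw [← ht2]
    nlinarith [sq_nonneg (t * (imbalance fun i => (x.next i : ℝ)) + x.unused j), hx j])
  have h5 : ∫ x, (imbalance fun i => (x.queue i : ℝ)) ^ 2 ∂μ ≤ imbalanceConst m A := h2.2
  have h6 := hμ.integral_unused_le hν hε j
  have hC : 0 ≤ imbalanceConst m A := (integral_nonneg fun x => sq_nonneg _).trans h5
  have h7 : ε * ∫ x, (imbalance fun i => (x.queue i : ℝ)) ^ 2 ∂μ + ∫ x, (x.unused j : ℝ) ∂μ
      ≤ t * (t * (imbalanceConst m A + 1)) := by
    rw [← mul_assoc, ← sq, ht2]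
    nlinarith [mul_le_mul_of_nonneg_left h5 hε.le]
  have h8 : 0 ≤ t * (imbalanceConst m A + 1) := by positivity
  rw [abs_le]
  constructor
  · nlinarith [le_of_mul_le_mul_left (a := t) (b := -(2 * imbalance fun i =>
      ∫ x, (x.next i : ℝ) * (x.unused j : ℝ) ∂μ)) (c := t * (imbalanceConst m A + 1))
      (by linarith) ht0]
  · nlinarith [le_of_mul_le_mul_left (a := t) (b := 2 * imbalance fun i =>
      ∫ x, (x.next i : ℝ) * (x.unused j : ℝ) ∂μ) (c := t * (imbalanceConst m A + 1))
      (by linarith) ht0]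

end SteadyState

/-! ### Underdetermination of the linear system -/

section LinearSystem

/-- The linear system has a solution with any prescribed value of any one mean queue length. -/
theorem exists_quadraticSystem (σ : Fin 4 → ℝ) (i : Fin 3) (t : ℝ) :
    ∃ (v : Fin 3 → ℝ) (w : Fin 8 → ℝ), QuadraticSystem σ v w ∧ v i = t := by
  set S := (σ 0 ^ 2 + σ 1 ^ 2 + σ 2 ^ 2 + σ 3 ^ 2) / 4 with hS
  set T := (σ 1 ^ 2 + σ 2 ^ 2) / 2 with hT
  -- With `w 1 = a`, `w 2 = b` and `w 3 = w 4 = w 7 = 0`, the six equations force all other entries.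
  -- Varying `a` moves `v 0`; varying `b` moves `v 1` and `v 2`.
  have h : ∀ a b : ℝ, QuadraticSystem σ
      ![(9 * σ 0 ^ 2 + σ 1 ^ 2 + σ 2 ^ 2 + σ 3 ^ 2) / 16 + (S + 2 * a - b) / 2,
        (σ 0 ^ 2 + 9 * σ 1 ^ 2 + σ 2 ^ 2 + σ 3 ^ 2) / 16 + b / 2,
        (σ 0 ^ 2 + σ 1 ^ 2 + 9 * σ 2 ^ 2 + σ 3 ^ 2) / 16 + (2 * S - b - 2 * T) / 2]
      ![S + a - b, a, b, 0, 0, 2 * S - b - T, T, 0] := by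
    intro a b
    simp only [QuadraticSystem, hS, hT]
    simp
    refine ⟨?_, ?_, ?_, ?_, ?_, ?_⟩ <;> ring
  fin_cases i
  · refine ⟨_, _, h ((t - (9 * σ 0 ^ 2 + σ 1 ^ 2 + σ 2 ^ 2 + σ 3 ^ 2) / 16) - S / 2) 0, ?_⟩
    simp
    ring
  · refine ⟨_, _, h 0 (2 * (t - (σ 0 ^ 2 + 9 * σ 1 ^ 2 + σ 2 ^ 2 + σ 3 ^ 2) / 16)), ?_⟩
    simp
  · refine ⟨_, _, h 0 (2 * S - 2 * T
      - 2 * (t - (σ 0 ^ 2 + σ 1 ^ 2 + 9 * σ 2 ^ 2 + σ 3 ^ 2) / 16)), ?_⟩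
    simp
    ring

end LinearSystem

/-! ### Projection rows and the heavy-traffic limit -/

/-- The rows of the matrix of the orthogonal projection on `collapseSpace`. -/
noncomputable def projForm : Fin 4 → Fin 4 → ℝ :=
  ![![3 / 4, 1 / 4, 1 / 4, -1 / 4], ![1 / 4, 3 / 4, -1 / 4, 1 / 4],
    ![1 / 4, -1 / 4, 3 / 4, 1 / 4], ![-1 / 4, 1 / 4, 1 / 4, 3 / 4]]

/-- The coefficients of the linear form `imbalance`. -/
def imbalanceSign : Fin 4 → ℝ := ![1, -1, -1, 1]

theorem isBalancedForm_projForm (i : Fin 4) : IsBalancedForm (projForm i) (1 / 2) := by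
  constructor <;> fin_cases i <;> simp [projForm] <;> norm_num

/-- The matrix is `I - e eᵀ / 4` with `e = imbalanceSign`, which spans the normal direction to the
balanced vectors. -/
theorem sum_projForm_mul (i : Fin 4) (f : Fin 4 → ℝ) :
    ∑ k, projForm i k * f k = f i - imbalanceSign i / 4 * imbalance f := by
  fin_cases i <;> simp [projForm, imbalanceSign, imbalance, Fin.sum_univ_four] <;> ring

section HeavyTraffic

variable {μ : ℝ → Measure Slot} [∀ ε, IsProbabilityMeasure (μ ε)] {ν σ : Fin 4 → ℝ}
  {var : ℝ → Fin 4 → ℝ} {m : ℝ} {A : ℕ}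

theorem eventually_small (hm : 0 < m) :
    ∀ᶠ ε in 𝓝[>] (0 : ℝ), ε ∈ Set.Ioo (0 : ℝ) 1 ∧ ε ≤ m / 8 := by
  filter_upwards [Ioo_mem_nhdsGT (show (0 : ℝ) < 1 by norm_num),
    Ioo_mem_nhdsGT (show 0 < m / 8 by positivity)] with ε h1 h2 using ⟨h1, h2.2.le⟩

theorem tendsto_id_nhdsGT : Tendsto (fun ε : ℝ => ε) (𝓝[>] 0) (𝓝 0) :=
  tendsto_nhdsWithin_of_tendsto_nhds tendsto_id

theorem tendsto_unused_mul_unused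
    (hμ : ∀ ε ∈ Set.Ioo (0 : ℝ) 1, IsSteadySlot (μ ε) (fun i => (1 - ε) * ν i) (var ε) A)
    (hν : IsSaturated ν m) (i j : Fin 4) :
    Tendsto (fun ε => ∫ x, (x.unused i : ℝ) * (x.unused j : ℝ) ∂(μ ε)) (𝓝[>] 0) (𝓝 0) := by
  refine tendsto_of_tendsto_of_tendsto_of_le_of_le' tendsto_const_nhds tendsto_id_nhdsGT
    (Eventually.of_forall fun ε => integral_nonneg fun x => ?_) ?_
  · show (0 : ℝ) ≤ (x.unused i : ℝ) * (x.unused j : ℝ)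
    positivity
  · filter_upwards [eventually_small hν.pos] with ε hε
    exact (hμ ε hε.1).integral_unused_mul_unused_le hν hε.1.1 i j

theorem tendsto_imbalance_queue
    (hμ : ∀ ε ∈ Set.Ioo (0 : ℝ) 1, IsSteadySlot (μ ε) (fun i => (1 - ε) * ν i) (var ε) A)
    (hν : IsSaturated ν m) :
    Tendsto (fun ε => ε * imbalance fun i => ∫ x, (x.queue i : ℝ) ∂(μ ε)) (𝓝[>] 0) (𝓝 0) := by
  refine squeeze_zero_norm' (a := fun ε => ε * (imbalanceConst m A + 1)) ?_ (by
    simpa using tendsto_id_nhdsGT.mul_const (imbalanceConst m A + 1))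
  filter_upwards [eventually_small hν.pos] with ε hε
  rw [norm_mul, Real.norm_of_nonneg hε.1.1.le]
  exact mul_le_mul_of_nonneg_left ((hμ ε hε.1).abs_imbalance_queue_le hν hε.1.1 hε.2) hε.1.1.le

theorem tendsto_imbalance_cross
    (hμ : ∀ ε ∈ Set.Ioo (0 : ℝ) 1, IsSteadySlot (μ ε) (fun i => (1 - ε) * ν i) (var ε) A)
    (hν : IsSaturated ν m) (j : Fin 4) :
    Tendsto (fun ε => imbalance fun i => ∫ x, (x.next i : ℝ) * (x.unused j : ℝ) ∂(μ ε))
      (𝓝[>] 0) (𝓝 0) := by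
  refine squeeze_zero_norm' (a := fun ε => √ε * (imbalanceConst m A + 1)) ?_ ?_
  · filter_upwards [eventually_small hν.pos] with ε hε
    exact (hμ ε hε.1).abs_imbalance_cross_le hν hε.1.1 hε.2 j
  · have : Tendsto (fun ε : ℝ => √ε) (𝓝[>] 0) (𝓝 0) := by
      have h := (Real.continuous_sqrt.tendsto 0).comp tendsto_id_nhdsGT
      rwa [Real.sqrt_zero] at h
    simpa using this.mul_const (imbalanceConst m A + 1)

/-- Heavy-traffic limit of the zero drift of the product of two projected queue lengths. -/
theorem tendsto_projected_drift
    (hμ : ∀ ε ∈ Set.Ioo (0 : ℝ) 1, IsSteadySlot (μ ε) (fun i => (1 - ε) * ν i) (var ε) A)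
    (hν : IsSaturated ν m)
    (hvar : ∀ i, Tendsto (fun ε => var ε i) (𝓝[>] 0) (𝓝 (σ i ^ 2))) (i j : Fin 4) :
    Tendsto (fun ε => ε / 2 * (∫ x, (x.queue i : ℝ) ∂(μ ε) + ∫ x, (x.queue j : ℝ) ∂(μ ε))
      - ∑ l, projForm j l * ∫ x, (x.next i : ℝ) * (x.unused l : ℝ) ∂(μ ε)
      - ∑ l, projForm i l * ∫ x, (x.next j : ℝ) * (x.unused l : ℝ) ∂(μ ε))
      (𝓝[>] 0) (𝓝 (∑ k, projForm i k * projForm j k * σ k ^ 2)) := by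
  have hU : Tendsto (fun ε => ∑ k, ∑ l, projForm i k * projForm j l
      * ∫ x, (x.unused k : ℝ) * (x.unused l : ℝ) ∂(μ ε)) (𝓝[>] 0) (𝓝 0) := by
    simpa using tendsto_finsetSum Finset.univ fun k _ => tendsto_finsetSum Finset.univ fun l _ =>
      (tendsto_unused_mul_unused hμ hν k l).const_mul (projForm i k * projForm j l)
  have hV : Tendsto (fun ε => ∑ k, projForm i k * projForm j k * var ε k) (𝓝[>] 0)
      (𝓝 (∑ k, projForm i k * projForm j k * σ k ^ 2)) :=
    tendsto_finsetSum _ fun k _ => (hvar k).const_mul _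
  have hε2 : Tendsto (fun ε : ℝ => ε ^ 2 * (1 / 2) * (1 / 2)) (𝓝[>] 0) (𝓝 0) := by
    have h := ((tendsto_id_nhdsGT.pow 2).mul_const (1 / 2 : ℝ)).mul_const (1 / 2 : ℝ)
    norm_num at h ⊢
    exact h
  -- Together with `hC`, this is the price of replacing projected queues by queues: every correction
  -- carries a factor of imbalance and vanishes by state space collapse.
  have hW := (tendsto_imbalance_queue hμ hν).const_mul ((imbalanceSign i + imbalanceSign j) / 8)
  have hC : ∀ i j, Tendsto (fun ε => imbalanceSign i / 4 * ∑ l, projForm j l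
      * imbalance fun k => ∫ x, (x.next k : ℝ) * (x.unused l : ℝ) ∂(μ ε)) (𝓝[>] 0) (𝓝 0) := by
    intro i j
    simpa using (tendsto_finsetSum Finset.univ fun l _ =>
      (tendsto_imbalance_cross hμ hν l).const_mul (projForm j l)).const_mul (imbalanceSign i / 4)
  have hall := (((((hU.neg.add hV).add hε2).add hW).sub (hC i j)).sub (hC j i))
  simp only [neg_zero, zero_add, mul_zero, add_zero, sub_zero] at hall
  refine hall.congr' ?_
  filter_upwards [eventually_small hν.pos] with ε hε
  have h := (hμ ε hε.1).quadratic_drift hν hε.1.1 (isBalancedForm_projForm i)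
    (isBalancedForm_projForm j)
  have hx : ∑ k, ∑ l, (projForm i k * projForm j l + projForm j k * projForm i l)
      * ∫ x, (x.next k : ℝ) * (x.unused l : ℝ) ∂(μ ε)
      = ∑ l, projForm j l * (∑ k, projForm i k * ∫ x, (x.next k : ℝ) * (x.unused l : ℝ) ∂(μ ε))
        + ∑ l, projForm i l
          * (∑ k, projForm j k * ∫ x, (x.next k : ℝ) * (x.unused l : ℝ) ∂(μ ε)) := by
    rw [Finset.sum_comm, ← Finset.sum_add_distrib]
    refine Finset.sum_congr rfl fun l _ => ?_
    rw [Finset.mul_sum, Finset.mul_sum, ← Finset.sum_add_distrib]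
    exact Finset.sum_congr rfl fun k _ => by ring
  have hd : ∀ i j, ∑ l, projForm j l * (∑ k, projForm i k
      * ∫ x, (x.next k : ℝ) * (x.unused l : ℝ) ∂(μ ε))
      = ∑ l, projForm j l * ∫ x, (x.next i : ℝ) * (x.unused l : ℝ) ∂(μ ε)
        - imbalanceSign i / 4 * ∑ l, projForm j l
          * imbalance fun k => ∫ x, (x.next k : ℝ) * (x.unused l : ℝ) ∂(μ ε) := by
    intro i j
    rw [Finset.mul_sum, ← Finset.sum_sub_distrib]
    refine Finset.sum_congr rfl fun l _ => ?_
    rw [sum_projForm_mul]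
    ring
  rw [hx, hd, hd, sum_projForm_mul i, sum_projForm_mul j] at h
  linear_combination (-1) * h

theorem isBigO_one_of_le {f : ℝ → ℝ} {R : ℝ} (h0 : ∀ᶠ ε in 𝓝[>] (0 : ℝ), 0 ≤ f ε)
    (h : ∀ᶠ ε in 𝓝[>] (0 : ℝ), f ε ≤ R) : f =O[𝓝[>] (0 : ℝ)] (fun _ => (1 : ℝ)) := by
  refine IsBigO.of_bound R ?_
  filter_upwards [h0, h] with ε h1 h2
  simpa [abs_of_nonneg h1] using h2

theorem isBigO_cross_of_port
    (hμ : ∀ ε ∈ Set.Ioo (0 : ℝ) 1, IsSteadySlot (μ ε) (fun i => (1 - ε) * ν i) (var ε) A)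
    (hν : IsSaturated ν m) (hvar : ∀ ε i, 0 ≤ var ε i) {i j : Fin 4} (hij : i ≠ j)
    (hij' : i + j ≠ 3) :
    (fun ε => ∫ x, (x.next i : ℝ) * (x.unused j : ℝ) ∂(μ ε)) =O[𝓝[>] (0 : ℝ)]
      (fun _ => (1 : ℝ)) := by
  refine isBigO_one_of_le (R := 4 * (((A : ℝ) + 1) ^ 2 / m + 1))
    (Eventually.of_forall fun ε => integral_next_mul_unused_nonneg i j) ?_
  filter_upwards [eventually_small hν.pos] with ε hε
  refine ((hμ ε hε.1).cross_le hν hε.1.1 (hvar ε) hij hij').trans ?_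
  have := hε.1.2.le
  gcongr

/-- Six of the pairs share a port. For `(1, 2)` and `(2, 1)` the balance relation expresses the
cross term through two pairs that do, a vanishing imbalance, and a term `q⁺ j * u j = 0`. -/
theorem isBigO_cross
    (hμ : ∀ ε ∈ Set.Ioo (0 : ℝ) 1, IsSteadySlot (μ ε) (fun i => (1 - ε) * ν i) (var ε) A)
    (hν : IsSaturated ν m) (hvar : ∀ ε i, 0 ≤ var ε i) (k : Fin 8) :
    (fun ε => ∫ x, (x.next (crossPair k).1 : ℝ) * (x.unused (crossPair k).2 : ℝ) ∂(μ ε))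
      =O[𝓝[>] (0 : ℝ)] (fun _ => (1 : ℝ)) := by
  have hp := fun {i j : Fin 4} (hij : i ≠ j) (hij' : i + j ≠ 3) =>
    isBigO_cross_of_port hμ hν hvar hij hij'
  have hw := fun j => (tendsto_imbalance_cross hμ hν j).isBigO_one ℝ
  have h12 : (fun ε => ∫ x, (x.next 1 : ℝ) * (x.unused 2 : ℝ) ∂(μ ε)) =O[𝓝[>] (0 : ℝ)]
      (fun _ => (1 : ℝ)) := by
    refine (((hp (i := 0) (j := 2) (by decide) (by decide)).add
      (hp (i := 3) (j := 2) (by decide) (by decide))).sub (hw 2)).congr_left fun ε => ?_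
    have := integral_next_mul_unused_self (μ := μ ε) 2
    simp only [imbalance]
    linear_combination this
  have h21 : (fun ε => ∫ x, (x.next 2 : ℝ) * (x.unused 1 : ℝ) ∂(μ ε)) =O[𝓝[>] (0 : ℝ)]
      (fun _ => (1 : ℝ)) := by
    refine (((hp (i := 0) (j := 1) (by decide) (by decide)).add
      (hp (i := 3) (j := 1) (by decide) (by decide))).sub (hw 1)).congr_left fun ε => ?_
    have := integral_next_mul_unused_self (μ := μ ε) 1
    simp only [imbalance]
    linear_combination this
  fin_cases k
  · exact hp (i := 0) (j := 1) (by decide) (by decide)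
  · exact hp (i := 0) (j := 2) (by decide) (by decide)
  · exact hp (i := 1) (j := 0) (by decide) (by decide)
  · exact h12
  · exact hp (i := 1) (j := 3) (by decide) (by decide)
  · exact hp (i := 2) (j := 0) (by decide) (by decide)
  · exact h21
  · exact hp (i := 2) (j := 3) (by decide) (by decide)

end HeavyTraffic

/-! ### Assembly of the theorem -/

theorem exists_isSaturated {ν : EuclideanSpace ℝ (Fin 4)} (hν_pos : ∀ i, 0 < ν i)
    (hν_sat : ∀ l, inner ℝ (portVec l) ν = 1) : ∃ m, IsSaturated (fun i => ν i) m := by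
  have h0 := hν_sat 0
  have h1 := hν_sat 1
  have h2 := hν_sat 2
  simp [portVec, PiLp.inner_apply, Fin.sum_univ_four] at h0 h1 h2
  have e2 : ν 2 = ν 1 := by linarith
  have e3 : ν 3 = ν 0 := by linarith
  refine ⟨min (ν 0) (ν 1), lt_min (hν_pos 0) (hν_pos 1), fun i => ?_, by linarith, by linarith,
    e3⟩
  fin_cases i
  · exact min_le_left _ _
  · exact min_le_right _ _
  · exact (min_le_right _ _).trans e2.ge
  · exact (min_le_left _ _).trans e3.ge

end InputQueuedSwitch

theorem theorem2
    -- the critical arrival rate vector of a completely saturated switch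
    (ν : EuclideanSpace ℝ (Fin 4)) (hν_pos : ∀ i, 0 < ν i)
    (hν_sat : ∀ l, inner ℝ (portVec l) ν = 1)
    -- arrivals to the four queues in the system with parameter `ε`
    (α : ℝ → Fin 4 → Measure ℕ) [∀ ε i, IsProbabilityMeasure (α ε i)]
    (Amax : ℕ) (hα_bdd : ∀ ε ∈ Set.Ioo (0 : ℝ) 1, ∀ i, ∀ᵐ n ∂(α ε i), n ≤ Amax)
    (hα_mean : ∀ ε ∈ Set.Ioo (0 : ℝ) 1, ∀ i, ∫ n, (n : ℝ) ∂(α ε i) = (1 - ε) * ν i)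
    (σ : Fin 4 → ℝ)
    (hα_var : ∀ i, Tendsto (fun ε => variance (fun n : ℕ => (n : ℝ)) (α ε i))
      (𝓝[>] (0 : ℝ)) (𝓝 (σ i ^ 2)))
    -- MaxWeight scheduling with random tie-breaking
    (κ : ℝ → Kernel Vec Vec) [∀ ε, IsMarkovKernel (κ ε)]
    (hκ : ∀ ε ∈ Set.Ioo (0 : ℝ) 1, IsMaxWeightPolicy (κ ε))
    -- the steady state of the Markov chain of queue lengths
    (π : ℝ → Measure Vec) [∀ ε, IsProbabilityMeasure (π ε)]
    (hπ : ∀ ε ∈ Set.Ioo (0 : ℝ) 1, Kernel.Invariant (transition (α ε) (κ ε)) (π ε)) :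
    -- all the expectations are finite
    (∀ ε ∈ Set.Ioo (0 : ℝ) 1,
      (∀ i, Integrable (fun x : Slot => (x.queue i : ℝ)) (slotLaw (α ε) (κ ε) (π ε))) ∧
      (∀ i j, Integrable (fun x : Slot => (x.next i : ℝ) * (x.unused j : ℝ))
        (slotLaw (α ε) (κ ε) (π ε))) ∧
      (∀ i j, Integrable (fun x : Slot => monomial i j x.queue) (slotLaw (α ε) (κ ε) (π ε))) ∧
      (∀ i j, Integrable (fun x : Slot => monomial i j x.next) (slotLaw (α ε) (κ ε) (π ε)))) ∧
    -- the drift of every quadratic monomial is zero in steady state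
    (∀ ε ∈ Set.Ioo (0 : ℝ) 1, ∀ i j,
      ∫ x : Slot, (monomial i j x.next - monomial i j x.queue)
        ∂(slotLaw (α ε) (κ ε) (π ε)) = 0) ∧
    -- the eleven quantities stay bounded in heavy traffic
    (∀ i, (fun ε => scaledMean α κ π ε i) =O[𝓝[>] (0 : ℝ)] (fun _ => (1 : ℝ))) ∧
    (∀ k, (fun ε => crossMean α κ π ε (crossPair k).1 (crossPair k).2)
      =O[𝓝[>] (0 : ℝ)] (fun _ => (1 : ℝ))) ∧
    -- the six equations hold in the limit, whether or not the separate limits exist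
    Tendsto (fun ε => scaledMean α κ π ε 0
        - 1 / 2 * (crossMean α κ π ε 0 1 + crossMean α κ π ε 0 2)
        + 1 / 2 * (crossMean α κ π ε 1 3 + crossMean α κ π ε 2 3))
      (𝓝[>] (0 : ℝ)) (𝓝 ((9 * σ 0 ^ 2 + σ 1 ^ 2 + σ 2 ^ 2 + σ 3 ^ 2) / 16)) ∧
    Tendsto (fun ε => scaledMean α κ π ε 1
        - 1 / 2 * (crossMean α κ π ε 1 0 - crossMean α κ π ε 1 2 + crossMean α κ π ε 1 3))
      (𝓝[>] (0 : ℝ)) (𝓝 ((σ 0 ^ 2 + 9 * σ 1 ^ 2 + σ 2 ^ 2 + σ 3 ^ 2) / 16)) ∧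
    Tendsto (fun ε => scaledMean α κ π ε 2
        - 1 / 2 * (crossMean α κ π ε 2 0 - crossMean α κ π ε 2 1 + crossMean α κ π ε 2 3))
      (𝓝[>] (0 : ℝ)) (𝓝 ((σ 0 ^ 2 + σ 1 ^ 2 + 9 * σ 2 ^ 2 + σ 3 ^ 2) / 16)) ∧
    Tendsto (fun ε => scaledMean α κ π ε 0 + scaledMean α κ π ε 1
        - 1 / 2 * (3 * crossMean α κ π ε 0 1 - crossMean α κ π ε 0 2)
        - 1 / 2 * (3 * crossMean α κ π ε 1 0 + crossMean α κ π ε 1 2)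
        - 1 / 2 * crossMean α κ π ε 2 3)
      (𝓝[>] (0 : ℝ)) (𝓝 ((3 * σ 0 ^ 2 + 3 * σ 1 ^ 2 - σ 2 ^ 2 - σ 3 ^ 2) / 8)) ∧
    Tendsto (fun ε => scaledMean α κ π ε 0 + scaledMean α κ π ε 2
        - 1 / 2 * (-crossMean α κ π ε 0 1 + 3 * crossMean α κ π ε 0 2)
        - 1 / 2 * crossMean α κ π ε 1 3
        - 1 / 2 * (3 * crossMean α κ π ε 2 0 + crossMean α κ π ε 2 1))
      (𝓝[>] (0 : ℝ)) (𝓝 ((3 * σ 0 ^ 2 - σ 1 ^ 2 + 3 * σ 2 ^ 2 - σ 3 ^ 2) / 8)) ∧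
    Tendsto (fun ε => scaledMean α κ π ε 1 + scaledMean α κ π ε 2
        - 1 / 2 * (crossMean α κ π ε 1 0 + 3 * crossMean α κ π ε 1 2 + crossMean α κ π ε 1 3)
        - 1 / 2 * (crossMean α κ π ε 2 0 + 3 * crossMean α κ π ε 2 1 + crossMean α κ π ε 2 3))
      (𝓝[>] (0 : ℝ)) (𝓝 ((σ 0 ^ 2 - 3 * σ 1 ^ 2 - 3 * σ 2 ^ 2 + σ 3 ^ 2) / 8)) ∧
    -- the limits, along `ε ↓ 0` or along any sequence or finer filter, solve the system
    (∀ (l : Filter ℝ), l.NeBot → l ≤ 𝓝[>] (0 : ℝ) → ∀ (v : Fin 3 → ℝ) (w : Fin 8 → ℝ),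
      (∀ i : Fin 3, Tendsto (fun ε => scaledMean α κ π ε i.castSucc) l (𝓝 (v i))) →
      (∀ k : Fin 8, Tendsto
        (fun ε => crossMean α κ π ε (crossPair k).1 (crossPair k).2) l (𝓝 (w k))) →
      QuadraticSystem σ v w) ∧
    -- the system is underdetermined: it leaves each `lim ε E[q i]` completely free
    (∀ (i : Fin 3) (t : ℝ), ∃ (v : Fin 3 → ℝ) (w : Fin 8 → ℝ),
      QuadraticSystem σ v w ∧ v i = t) := by
  obtain ⟨m, hν⟩ := exists_isSaturated hν_pos hν_sat
  have hμ : ∀ ε ∈ Set.Ioo (0 : ℝ) 1, IsSteadySlot (slotLaw (α ε) (κ ε) (π ε))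
      (fun i => (1 - ε) * ν i) (fun i => variance (fun n : ℕ => (n : ℝ)) (α ε i)) Amax :=
    fun ε hε => isSteadySlot_slotLaw (α ε) (κ ε) (π ε) (hα_bdd ε hε) (hα_mean ε hε) (hκ ε hε)
      (hπ ε hε)
  have hvar0 : ∀ ε i, 0 ≤ variance (fun n : ℕ => (n : ℝ)) (α ε i) := fun ε i => variance_nonneg _ _
  have hmono : ∀ ε ∈ Set.Ioo (0 : ℝ) 1, ∀ i j,
      Integrable (fun x : Slot => monomial i j x.queue) (slotLaw (α ε) (κ ε) (π ε)) :=
    fun ε hε i j => (hμ ε hε).integrable_monomial hν hε.1 i j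
  have hmono' : ∀ ε ∈ Set.Ioo (0 : ℝ) 1, ∀ i j,
      Integrable (fun x : Slot => monomial i j x.next) (slotLaw (α ε) (κ ε) (π ε)) :=
    fun ε hε i j => (integrable_next_iff (hμ ε hε).map_next (monomial i j)).2 (hmono ε hε i j)
  have hT := tendsto_projected_drift hμ hν hα_var
  -- Collapse against `u 3` says `E[q⁺ 0 * u 3]` and `E[(q⁺ 1 + q⁺ 2) * u 3]` agree in the limit.
  -- This removes the former from the three equations that involve row `0`.
  have hw3 := (tendsto_imbalance_cross hμ hν 3).const_mul (1 / 2)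
  rw [mul_zero] at hw3
  have hself := fun ε => integral_next_mul_unused_self (μ := slotLaw (α ε) (κ ε) (π ε))
  have hcross := isBigO_cross hμ hν hvar0
  have E1 : Tendsto (fun ε => scaledMean α κ π ε 0
        - 1 / 2 * (crossMean α κ π ε 0 1 + crossMean α κ π ε 0 2)
        + 1 / 2 * (crossMean α κ π ε 1 3 + crossMean α κ π ε 2 3))
      (𝓝[>] (0 : ℝ)) (𝓝 ((9 * σ 0 ^ 2 + σ 1 ^ 2 + σ 2 ^ 2 + σ 3 ^ 2) / 16)) := by
    refine (((hT 0 0).sub hw3).congr fun ε => ?_).trans_eq ?_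
    · simp only [scaledMean, crossMean, imbalance, projForm, Fin.sum_univ_four]
      simp
      linear_combination (-3 / 2) * hself ε 0 - 1 / 2 * hself ε 3
    · simp only [projForm, Fin.sum_univ_four]
      simp
      ring
  have E2 : Tendsto (fun ε => scaledMean α κ π ε 1
        - 1 / 2 * (crossMean α κ π ε 1 0 - crossMean α κ π ε 1 2 + crossMean α κ π ε 1 3))
      (𝓝[>] (0 : ℝ)) (𝓝 ((σ 0 ^ 2 + 9 * σ 1 ^ 2 + σ 2 ^ 2 + σ 3 ^ 2) / 16)) := by
    refine ((hT 1 1).congr fun ε => ?_).trans_eq ?_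
    · simp only [scaledMean, crossMean, projForm, Fin.sum_univ_four]
      simp
      linear_combination (-3 / 2) * hself ε 1
    · simp only [projForm, Fin.sum_univ_four]
      simp
      ring
  have E3 : Tendsto (fun ε => scaledMean α κ π ε 2
        - 1 / 2 * (crossMean α κ π ε 2 0 - crossMean α κ π ε 2 1 + crossMean α κ π ε 2 3))
      (𝓝[>] (0 : ℝ)) (𝓝 ((σ 0 ^ 2 + σ 1 ^ 2 + 9 * σ 2 ^ 2 + σ 3 ^ 2) / 16)) := by
    refine ((hT 2 2).congr fun ε => ?_).trans_eq ?_
    · simp only [scaledMean, crossMean, projForm, Fin.sum_univ_four]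
      simp
      linear_combination (-3 / 2) * hself ε 2
    · simp only [projForm, Fin.sum_univ_four]
      simp
      ring
  have E4 : Tendsto (fun ε => scaledMean α κ π ε 0 + scaledMean α κ π ε 1
        - 1 / 2 * (3 * crossMean α κ π ε 0 1 - crossMean α κ π ε 0 2)
        - 1 / 2 * (3 * crossMean α κ π ε 1 0 + crossMean α κ π ε 1 2)
        - 1 / 2 * crossMean α κ π ε 2 3)
      (𝓝[>] (0 : ℝ)) (𝓝 ((3 * σ 0 ^ 2 + 3 * σ 1 ^ 2 - σ 2 ^ 2 - σ 3 ^ 2) / 8)) := by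
    refine ((((hT 0 1).const_mul 2).add hw3).congr fun ε => ?_).trans_eq ?_
    · simp only [scaledMean, crossMean, imbalance, projForm, Fin.sum_univ_four]
      simp
      linear_combination (-1 / 2) * hself ε 0 - 1 / 2 * hself ε 1 + 1 / 2 * hself ε 3
    · simp only [projForm, Fin.sum_univ_four]
      simp
      ring
  have E5 : Tendsto (fun ε => scaledMean α κ π ε 0 + scaledMean α κ π ε 2
        - 1 / 2 * (-crossMean α κ π ε 0 1 + 3 * crossMean α κ π ε 0 2)
        - 1 / 2 * crossMean α κ π ε 1 3
        - 1 / 2 * (3 * crossMean α κ π ε 2 0 + crossMean α κ π ε 2 1))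
      (𝓝[>] (0 : ℝ)) (𝓝 ((3 * σ 0 ^ 2 - σ 1 ^ 2 + 3 * σ 2 ^ 2 - σ 3 ^ 2) / 8)) := by
    refine ((((hT 0 2).const_mul 2).add hw3).congr fun ε => ?_).trans_eq ?_
    · simp only [scaledMean, crossMean, imbalance, projForm, Fin.sum_univ_four]
      simp
      linear_combination (-1 / 2) * hself ε 0 - 1 / 2 * hself ε 2 + 1 / 2 * hself ε 3
    · simp only [projForm, Fin.sum_univ_four]
      simp
      ring
  have E6 : Tendsto (fun ε => scaledMean α κ π ε 1 + scaledMean α κ π ε 2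
        - 1 / 2 * (crossMean α κ π ε 1 0 + 3 * crossMean α κ π ε 1 2 + crossMean α κ π ε 1 3)
        - 1 / 2 * (crossMean α κ π ε 2 0 + 3 * crossMean α κ π ε 2 1 + crossMean α κ π ε 2 3))
      (𝓝[>] (0 : ℝ)) (𝓝 ((σ 0 ^ 2 - 3 * σ 1 ^ 2 - 3 * σ 2 ^ 2 + σ 3 ^ 2) / 8)) := by
    refine (((hT 1 2).const_mul 2).congr fun ε => ?_).trans_eq ?_
    · simp only [scaledMean, crossMean, projForm, Fin.sum_univ_four]
      simp
      linear_combination 1 / 2 * hself ε 1 + 1 / 2 * hself ε 2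
    · simp only [projForm, Fin.sum_univ_four]
      simp
      ring
  refine ⟨fun ε hε => ⟨(hμ ε hε).integrable_queue hν hε.1, fun i j =>
      ((hμ ε hε).hasMean_next_mul_unused hν hε.1 i j).1, hmono ε hε, hmono' ε hε⟩,
    fun ε hε i j => ?_, fun i => ?_, hcross, E1, E2, E3, E4, E5, E6, ?_,
    exists_quadraticSystem σ⟩
  · rw [integral_sub (hmono' ε hε i j) (hmono ε hε i j),
      integral_next_eq (hμ ε hε).map_next (monomial i j), sub_self]
  · refine isBigO_one_of_le (R := 2 * ((Amax : ℝ) + 1) ^ 2 / m) ?_ ?_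
    · filter_upwards [self_mem_nhdsWithin] with ε hε
      exact mul_nonneg (le_of_lt hε) (integral_nonneg fun x => Nat.cast_nonneg _)
    · filter_upwards [eventually_small hν.pos] with ε hε
      exact (hμ ε hε.1).scaled_mean_le hν hε.1.1 i
  · intro l hl hle v w hv hw
    have v0 := hv 0
    have v1 := hv 1
    have v2 := hv 2
    have w0 := hw 0
    have w1 := hw 1
    have w2 := hw 2
    have w3 := hw 3
    have w4 := hw 4
    have w5 := hw 5
    have w6 := hw 6
    have w7 := hw 7
    have F1 := tendsto_nhds_unique (E1.mono_left hle)
      ((v0.sub ((w0.add w1).const_mul (1 / 2))).add ((w4.add w7).const_mul (1 / 2)))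
    have F2 := tendsto_nhds_unique (E2.mono_left hle)
      (v1.sub (((w2.sub w3).add w4).const_mul (1 / 2)))
    have F3 := tendsto_nhds_unique (E3.mono_left hle)
      (v2.sub (((w5.sub w6).add w7).const_mul (1 / 2)))
    have F4 := tendsto_nhds_unique (E4.mono_left hle)
      ((((v0.add v1).sub (((w0.const_mul 3).sub w1).const_mul (1 / 2))).sub
        (((w2.const_mul 3).add w3).const_mul (1 / 2))).sub (w7.const_mul (1 / 2)))
    have F5 := tendsto_nhds_unique (E5.mono_left hle)
      ((((v0.add v2).sub ((w0.neg.add (w1.const_mul 3)).const_mul (1 / 2))).sub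
        (w4.const_mul (1 / 2))).sub (((w5.const_mul 3).add w6).const_mul (1 / 2)))
    have F6 := tendsto_nhds_unique (E6.mono_left hle)
      (((v1.add v2).sub (((w2.add (w3.const_mul 3)).add w4).const_mul (1 / 2))).sub
        (((w5.add (w6.const_mul 3)).add w7).const_mul (1 / 2)))
    refine ⟨?_, ?_, ?_, ?_, ?_, ?_⟩ <;> linarith
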